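/- Let $n\ge 0$, $N\ge 1$, $m\in\mathbb R$, $0<\rho\le 1$, $0\le\delta<1$, and write the points of $\mathbb R^{n+1}=\mathbb R^n\times\mathbb R$ as $(x,t)$. A phase function on an open cone $\Gamma\subset Y\times(\mathbb R^N\setminus 0)$ ($Y$ a Euclidean space; cones are conic in $\theta\in\mathbb R^N$) is a function $\varphi\in C^\infty(\Gamma)$, positively homogeneous of degree $1$ in $\theta$, with $\operatorname{Im}\varphi\ge 0$ and $d\varphi\neq 0$ on $\Gamma$ (real-valued $\varphi$ are included). The conic support $\operatorname{cone\,supp}(a)$ of a symbol $a\in S^m_{\rho,\delta}(Y\times\mathbb R^N)$ is the smallest relatively closed conic subset of $Y\times(\mathbb R^N\setminus 0)$ that contains $\operatorname{supp}(a)\cap\{\theta\ne 0\}$. If $\varphi$ is a phase function on an open cone containing $\operatorname{cone\,supp}(a)$, the oscillatory integral $\int a(\cdot,\theta)e^{i\varphi(\cdot,\theta)}\,d\theta\in\mathcal D'(Y)$ is the weak limit, as $\varepsilon\downarrow 0$, of $\int\chi(\varepsilon\theta)a(\cdot,\theta)e^{i\varphi(\cdot,\theta)}\,d\theta$, for every $\chi\in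 C_c^\infty(\mathbb R^N)$ with $\chi(0)=1$. Let $u=\int a(\cdot,\theta)e^{i\varphi(\cdot,\theta)}\,d\theta\in\mathcal D'(\mathbb R^{n+1})$ be such an oscillatory integral with $a\in S^m_{\rho,\delta}(\mathbb R^{n+1}\times\mathbb R^N)$, and let $x\in\mathbb R^n$. Suppose that $$\mathrm{WF}(u)\cap\{(x,t;\xi,0)\mid t\in\mathbb R,\ \xi\in\mathbb R^n\}=\emptyset$$ and that $\partial_t\varphi(x,t,\theta)\neq 0$ for all $t$ and all $\theta\ne0$ with $(x,t,\theta)\in\operatorname{cone\,supp}(a)$. Then the restriction $u_x=\iota_x^*u\in\mathcal D'(\mathbb R)$ of $u$ to $\{x\}\times\mathbb R$ exists (where $\iota_x(t)=(x,t)$, and $\iota_x^*$ is the sequentially continuous extension of $f\mapsto f\circ\iota_x$ from smooth functions to the spaces $\mathcal D'_\Gamma(\mathbb R^{n+1})$, with $\Gamma$ a closed cone in $T^*\mathbb R^{n+1}\setminus 0$ not meeting $\{(x,t;\xi,0)\}$), $\varphi(x,\cdot,\cdot)$ is a phase function on an open cone containing $\operatorname{cone\,supp}(a(x,\cdot,\cdot))$,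 $a(x,\cdot,\cdot)\in S^m_{\rho,\delta}(\mathbb R\times\mathbb R^N)$, and $u_x$ is the one-dimensional oscillatory integral $$u_x=\int a(x,\cdot,\theta)\,e^{i\varphi(x,\cdot,\theta)}\,d\theta .$$ -/

import Mathlib

open MeasureTheory Filter TopologicalSpace
open scoped Topology ContDiff Distributions

noncomputable section

namespace OscInt

/-! ### Conic sets, phase functions, symbols -/

/-- A subset of `X × F` which is invariant under positive dilations of the second variable. -/
def IsConic {X F : Type*} [SMul ℝ F] (Γ : Set (X × F)) : Prop :=
  ∀ p ∈ Γ, ∀ r : ℝ, 0 < r → (p.1, r • p.2) ∈ Γ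

section Basic

variable {E F : Type*} [NormedAddCommGroup E] [NormedSpace ℝ E]
  [NormedAddCommGroup F] [NormedSpace ℝ F]

/-- `φ` is a phase function on the open cone `Γ ⊆ E × (F \ 0)`: smooth, positively homogeneous of
degree one in the second variable, with nonnegative imaginary part and without critical points.
Real valued phase functions are those with vanishing imaginary part. -/
structure IsPhaseFunction (Γ : Set (E × F)) (φ : E × F → ℂ) : Prop where
  isOpen : IsOpen Γ
  isConic : IsConic Γ
  ne_zero : ∀ p ∈ Γ, p.2 ≠ 0
  contDiffOn : ContDiffOn ℝ ∞ φ Γ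
  homogeneous : ∀ p ∈ Γ, ∀ r : ℝ, 0 < r → φ (p.1, r • p.2) = r * φ p
  im_nonneg : ∀ p ∈ Γ, 0 ≤ (φ p).im
  fderiv_ne_zero : ∀ p ∈ Γ, fderiv ℝ φ p ≠ 0

/-- The symbol class `S^m_{ρ,δ}(E × F)`: smooth functions `a` such that, for `y` in a compact set,
every derivative of order `k` in `θ` and order `l` in `y` is
`O((1 + |θ|) ^ (m - ρ k + δ l))`. -/
def IsSymbol (m ρ δ : ℝ) (a : E × F → ℂ) : Prop :=
  ContDiff ℝ ∞ a ∧
    ∀ K : Set E, IsCompact K → ∀ k l : ℕ, ∃ C : ℝ, ∀ y ∈ K, ∀ θ : F,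
      ‖iteratedFDeriv ℝ l (fun y' => iteratedFDeriv ℝ k (fun θ' => a (y', θ')) θ) y‖
        ≤ C * (1 + ‖θ‖) ^ (m - ρ * k + δ * l)

/-- The conic support of `a`: the smallest relatively closed conic subset of `E × (F \ 0)`
containing the part of the support of `a` in `E × (F \ 0)`. -/
def coneSupport (a : E × F → ℂ) : Set (E × F) :=
  closure {p | ∃ q ∈ tsupport a, q.2 ≠ 0 ∧ ∃ r : ℝ, 0 < r ∧ p = (q.1, r • q.2)}
    ∩ {p | p.2 ≠ 0}

/-- The distribution `u` on `E` is the oscillatory integral `∫ a(·,θ) e^{iφ(·,θ)} dθ` with a symbol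
`a ∈ S^m_{ρ,δ}` and a function `φ` which is a phase function on an open cone containing the
conic support of `a`: it is the weak limit, as `ε ↓ 0`, of the absolutely convergent integrals
obtained by inserting a factor `χ(εθ)`, for every smooth compactly supported cutoff `χ` with
`χ(0) = 1`. -/
structure IsOscillatoryIntegral [MeasureSpace E] [MeasureSpace F] (m ρ δ : ℝ)
    (φ a : E × F → ℂ) (u : 𝓓'((⊤ : Opens E), ℂ)) : Prop where
  phase : ∃ Γ : Set (E × F), IsPhaseFunction Γ φ ∧ coneSupport a ⊆ Γ
  symbol : IsSymbol m ρ δ a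
  tendsto : ∀ χ : 𝓓((⊤ : Opens F), ℝ), χ 0 = 1 → ∀ ψ : 𝓓((⊤ : Opens E), ℝ),
    Tendsto
      (fun ε : ℝ => ∫ y : E,
        (∫ θ : F, (χ (ε • θ) : ℂ) * a (y, θ) * Complex.exp (Complex.I * φ (y, θ))) * (ψ y : ℂ))
      (𝓝[>] 0) (𝓝 (u ψ))

end Basic

/-! ### Wave front set -/

section WaveFront

variable {E : Type*} [NormedAddCommGroup E] [NormedSpace ℝ E]

/-- The test function `κ · (g ∘ ℓ)` for a smooth function `g` of one variable and a covector `ℓ`. -/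
def modulate (κ : 𝓓((⊤ : Opens E), ℝ)) (g : ℝ → ℝ) (hg : ContDiff ℝ ∞ g) (l : E →L[ℝ] ℝ) :
    𝓓((⊤ : Opens E), ℝ) where
  toFun y := κ y * g (l y)
  contDiff' := κ.contDiff.mul (hg.comp l.contDiff)
  hasCompactSupport' := κ.hasCompactSupport.mul_right
  tsupport_subset' := fun _ _ => trivial

/-- The Fourier transform of the compactly supported distribution `κ u` at the covector `ℓ`,
that is `⟨u, κ e^{-iℓ}⟩` (distributions are tested against real functions, so the exponential is
split into its real and imaginary part). -/
def localFourier (u : 𝓓'((⊤ : Opens E), ℂ)) (κ : 𝓓((⊤ : Opens E), ℝ)) (l : E →L[ℝ] ℝ) : ℂ :=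
  u (modulate κ Real.cos Real.contDiff_cos l)
    - Complex.I * u (modulate κ Real.sin Real.contDiff_sin l)

/-- The wave front set of `u`, a subset of `E × (E* \ 0)`. A point `(y, ℓ)` with `ℓ ≠ 0` is not
in it iff for some cutoff `κ` with `κ(y) ≠ 0` the Fourier transform of `κ u` decreases rapidly in
an open conic neighbourhood of `ℓ`. -/
def waveFrontSet (u : 𝓓'((⊤ : Opens E), ℂ)) : Set (E × (E →L[ℝ] ℝ)) :=
  {p | p.2 ≠ 0 ∧ ¬ ∃ κ : 𝓓((⊤ : Opens E), ℝ), κ p.1 ≠ 0 ∧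
    ∃ V : Set (E →L[ℝ] ℝ), IsOpen V ∧ p.2 ∈ V ∧ (∀ l ∈ V, ∀ r : ℝ, 0 < r → r • l ∈ V) ∧
      ∀ M : ℕ, ∃ C : ℝ, ∀ l ∈ V, (1 + ‖l‖) ^ M * ‖localFourier u κ l‖ ≤ C}

/-- `Γ` is a closed conic subset of `E × (E* \ 0)` (closed relative to `E × (E* \ 0)`). -/
structure IsClosedCone (Γ : Set (E × (E →L[ℝ] ℝ))) : Prop where
  ne_zero : ∀ p ∈ Γ, p.2 ≠ 0
  isConic : IsConic Γ
  isClosed : ∀ p ∈ closure Γ, p.2 ≠ 0 → p ∈ Γ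

/-- The sequence of smooth functions `f j` converges to `u` in the space `𝓓'_Γ` of distributions
whose wave front set is contained in the closed cone `Γ`: it converges weakly, and
`sup_{ℓ ∈ V} |ℓ|^M |(κ f_j - κ u)^(ℓ)| → 0` for all `M`, all cutoffs `κ` and all closed cones `V`
with `Γ ∩ (supp κ × V) = ∅`. -/
structure TendstoInCone [MeasureSpace E] (Γ : Set (E × (E →L[ℝ] ℝ))) (f : ℕ → E → ℂ)
    (u : 𝓓'((⊤ : Opens E), ℂ)) : Prop where
  contDiff : ∀ j, ContDiff ℝ ∞ (f j)
  waveFrontSet_subset : waveFrontSet u ⊆ Γ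
  weak : ∀ ψ : 𝓓((⊤ : Opens E), ℝ),
    Tendsto (fun j => ∫ y : E, f j y * (ψ y : ℂ)) atTop (𝓝 (u ψ))
  uniform : ∀ (κ : 𝓓((⊤ : Opens E), ℝ)) (V : Set (E →L[ℝ] ℝ)), IsClosed V →
    (∀ l ∈ V, ∀ r : ℝ, 0 < r → r • l ∈ V) → (∀ p ∈ Γ, p.1 ∈ tsupport κ → p.2 ∉ V) →
    ∀ (M : ℕ) (η : ℝ), 0 < η → ∀ᶠ j in atTop, ∀ l ∈ V,
      ‖l‖ ^ M * ‖(∫ y : E, f j y * (κ y : ℂ) * Complex.exp (-Complex.I * (l y : ℂ)))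
        - localFourier u κ l‖ ≤ η

end WaveFront

/-! ### Restriction to the line `{x} × ℝ` -/

/-- The space `ℝⁿ × ℝ` of pairs `(x, t)`. -/
abbrev SpaceTime (n : ℕ) : Type := EuclideanSpace ℝ (Fin n) × ℝ

/-- The conormal set of the line `{x} × ℝ`: all `(x, t; ξ, τ)` with `τ = 0`. -/
def conormal {n : ℕ} (x : EuclideanSpace ℝ (Fin n)) :
    Set (SpaceTime n × (SpaceTime n →L[ℝ] ℝ)) :=
  {p | p.1.1 = x ∧ p.2 (0, 1) = 0}

/-- `WF(u) ∩ {(x, t; ξ, 0)} = ∅`. -/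
def RestrictionCondition {n : ℕ} (x : EuclideanSpace ℝ (Fin n))
    (u : 𝓓'((⊤ : Opens (SpaceTime n)), ℂ)) : Prop :=
  waveFrontSet u ∩ conormal x = ∅

/-- `w` is the restriction (the pullback under `t ↦ (x, t)`) of `u` to `{x} × ℝ`, the pullback
being the sequentially continuous extension of the pullback of smooth functions: some sequence of
smooth functions converges to `u` in `𝓓'_Γ` for some closed cone `Γ` not meeting the conormal set
of `{x} × ℝ`, and for all such cones and sequences the restricted functions converge to `w`. -/
def IsRestriction {n : ℕ} (x : EuclideanSpace ℝ (Fin n))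
    (u : 𝓓'((⊤ : Opens (SpaceTime n)), ℂ)) (w : 𝓓'((⊤ : Opens ℝ), ℂ)) : Prop :=
  (∃ (Γ : Set (SpaceTime n × (SpaceTime n →L[ℝ] ℝ))) (f : ℕ → SpaceTime n → ℂ),
    IsClosedCone Γ ∧ Γ ∩ conormal x = ∅ ∧ TendstoInCone Γ f u) ∧
  ∀ (Γ : Set (SpaceTime n × (SpaceTime n →L[ℝ] ℝ))) (f : ℕ → SpaceTime n → ℂ),
    IsClosedCone Γ → Γ ∩ conormal x = ∅ → TendstoInCone Γ f u →
      ∀ ψ : 𝓓((⊤ : Opens ℝ), ℝ),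
        Tendsto (fun j => ∫ t : ℝ, f j (x, t) * (ψ t : ℂ)) atTop (𝓝 (w ψ))

/-- A distribution has at most one restriction. -/
theorem IsRestriction.unique {n : ℕ} {x : EuclideanSpace ℝ (Fin n)}
    {u : 𝓓'((⊤ : Opens (SpaceTime n)), ℂ)} {w w' : 𝓓'((⊤ : Opens ℝ), ℂ)}
    (h : IsRestriction x u w) (h' : IsRestriction x u w') : w = w' := by
  obtain ⟨Γ, f, h1, h2, h3⟩ := h.1
  ext ψ
  exact tendsto_nhds_unique (h.2 Γ f h1 h2 h3 ψ) (h'.2 Γ f h1 h2 h3 ψ)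

end OscInt

end

/-! The idea is to integrate in the base variable before integrating in `θ`. Where `|∂_w φ - ℓ(w)| ≥
c (|θ| + |ℓ|)` on the conic support, `k` integrations by parts along `w` gain `(|θ| + |ℓ|)^(-k)`,
while the derivatives of the symbol cost only `(1 + |θ|)^(δk)`. Since `δ < 1`, the base integral
decreases rapidly in both `θ` and `ℓ` (`norm_integral_mul_exp_le`, `exists_fiberIntegral_le`). The
integral over `θ` then converges absolutely, and the cutoff `χ(εθ)` is removed by dominated
convergence.

On the line, with `w = ∂_t` and `ℓ = 0`, this constructs the one-dimensional oscillatory integral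
`u_x` (`exists_isOscillatoryIntegral`).

On the whole space it shows that the regularizations `u_ε`, which are smooth by
`contDiff_regularized`, converge to `u` in `𝓓'_Λ`, where `Λ` is a closed cone without covectors `(ξ,
0)` over the line (`exists_tendstoInCone_regularized`). For `ℓ` nearly annihilated by `∂_t` there
are two cases: if `θ` dominates, `∂_t` is a good direction for the integration by parts; if `ℓ`
dominates, some basis vector is (`exists_decay_near_annihilator`).

Fourier inversion in the `x` variable expresses the restriction to the line, tested against `ψ`,
through Fourier transforms at covectors `(ξ, 0)` only. Hence any two sequences converging to `u` in
admissible spaces `𝓓'_Γ` have asymptotically equal restrictions (`tendsto_restriction_sub`). The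
restriction of `u_ε` is itself the regularization of the one-dimensional integral, so the common
limit is `u_x`. -/

set_option linter.unusedSectionVars false

noncomputable section

namespace OscInt

/-! ### Bounds for iterated derivatives along a fixed direction -/

section DerivBound

variable {E : Type*} [NormedAddCommGroup E] [NormedSpace ℝ E]

/-- On `S`, the iterated derivatives of order `j ≤ k` of `f` in the direction `w` are bounded by
`A * μ ^ j`. -/
def DerivBound (w : E) (S : Set E) : ℕ → (E → ℂ) → ℝ → ℝ → Prop
  | 0, f, A, _ => ∀ y ∈ S, ‖f y‖ ≤ A
  | k + 1, f, A, μ => (∀ y ∈ S, ‖f y‖ ≤ A) ∧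
      DerivBound w S k (fun y => fderiv ℝ f y w) (A * μ) μ

variable {w : E} {S U : Set E}

theorem DerivBound.norm_le {k : ℕ} {f : E → ℂ} {A μ : ℝ} (h : DerivBound w S k f A μ) :
    ∀ y ∈ S, ‖f y‖ ≤ A := by
  cases k with
  | zero => exact h
  | succ k => exact h.1

/-- Equality on `S` alone would not determine the derivatives at points of `S`; hence the open
neighbourhood `U`, which reappears in all rules below that differentiate. -/
theorem DerivBound.congr {k : ℕ} {f g : E → ℂ} {A μ : ℝ} (hU : IsOpen U) (hSU : S ⊆ U)
    (h : DerivBound w S k f A μ) (hfg : Set.EqOn f g U) : DerivBound w S k g A μ := by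
  induction k generalizing f g A with
  | zero => intro y hy; rw [← hfg (hSU hy)]; exact h y hy
  | succ k ih =>
    refine ⟨fun y hy => by rw [← hfg (hSU hy)]; exact h.1 y hy, ih h.2 fun y hy => ?_⟩
    have : f =ᶠ[𝓝 y] g := hfg.eventuallyEq_of_mem (hU.mem_nhds hy)
    simp only [this.fderiv_eq]

theorem DerivBound.mono {k : ℕ} {f : E → ℂ} {A A' μ : ℝ} (h : DerivBound w S k f A μ)
    (hA : A ≤ A') (hμ : 0 ≤ μ) : DerivBound w S k f A' μ := by
  induction k generalizing f A A' with
  | zero => exact fun y hy => (h y hy).trans hA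
  | succ k ih =>
    exact ⟨fun y hy => (h.1 y hy).trans hA, ih h.2 (mul_le_mul_of_nonneg_right hA hμ)⟩

/-- Brings factors with different costs per derivative, such as a symbol and a test function, to a
common scale before they are multiplied. -/
theorem DerivBound.mono_scale {k : ℕ} {f : E → ℂ} {A μ μ' : ℝ} (h : DerivBound w S k f A μ)
    (hA : 0 ≤ A) (hμ : 0 ≤ μ) (hμ' : μ ≤ μ') : DerivBound w S k f A μ' := by
  induction k generalizing f A with
  | zero => exact h
  | succ k ih =>
    exact ⟨h.1, (ih h.2 (mul_nonneg hA hμ)).mono (mul_le_mul_of_nonneg_left hμ' hA)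
      (hμ.trans hμ')⟩

theorem DerivBound.of_succ {k : ℕ} {f : E → ℂ} {A μ : ℝ} (h : DerivBound w S (k + 1) f A μ) :
    DerivBound w S k f A μ := by
  induction k generalizing f A with
  | zero => exact h.1
  | succ k ih => exact ⟨h.1, ih h.2⟩

theorem contDiffOn_fderiv_apply {f : E → ℂ} (hU : IsOpen U) (hf : ContDiffOn ℝ ∞ f U) (w : E) :
    ContDiffOn ℝ ∞ (fun y => fderiv ℝ f y w) U :=
  (hf.fderiv_of_isOpen hU (by simp)).clm_apply contDiffOn_const

theorem differentiableAt_of_contDiffOn {f : E → ℂ} (hU : IsOpen U) (hf : ContDiffOn ℝ ∞ f U)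
    {y : E} (hy : y ∈ U) : DifferentiableAt ℝ f y :=
  ((hf.contDiffAt (hU.mem_nhds hy)).differentiableAt (by simp))

theorem DerivBound.add {k : ℕ} {f g : E → ℂ} {A B μ : ℝ} (hU : IsOpen U) (hSU : S ⊆ U)
    (hf : ContDiffOn ℝ ∞ f U) (hg : ContDiffOn ℝ ∞ g U)
    (hfA : DerivBound w S k f A μ) (hgB : DerivBound w S k g B μ) :
    DerivBound w S k (fun y => f y + g y) (A + B) μ := by
  induction k generalizing f g A B with
  | zero => exact fun y hy => (norm_add_le _ _).trans (add_le_add (hfA y hy) (hgB y hy))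
  | succ k ih =>
    refine ⟨fun y hy => (norm_add_le _ _).trans (add_le_add (hfA.1 y hy) (hgB.1 y hy)), ?_⟩
    rw [add_mul]
    refine (ih (contDiffOn_fderiv_apply hU hf w) (contDiffOn_fderiv_apply hU hg w)
      hfA.2 hgB.2).congr hU hSU fun y hy => ?_
    simp only [fderiv_fun_add (differentiableAt_of_contDiffOn hU hf hy)
      (differentiableAt_of_contDiffOn hU hg hy), add_apply]

theorem fderiv_mul_apply {f g : E → ℂ} {y : E} (hf : DifferentiableAt ℝ f y)
    (hg : DifferentiableAt ℝ g y) (w : E) :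
    fderiv ℝ (fun z => f z * g z) y w = fderiv ℝ f y w * g y + f y * fderiv ℝ g y w := by
  rw [fderiv_fun_mul hf hg]
  simp only [add_apply, smul_apply, smul_eq_mul]
  ring

/-- Each application of the Leibniz rule doubles the number of terms, whence the factor `2 ^ k`. -/
theorem DerivBound.mul {k : ℕ} {f g : E → ℂ} {A B μ : ℝ} (hU : IsOpen U) (hSU : S ⊆ U)
    (hf : ContDiffOn ℝ ∞ f U) (hg : ContDiffOn ℝ ∞ g U) (hA : 0 ≤ A) (hB : 0 ≤ B) (hμ : 0 ≤ μ)
    (hfA : DerivBound w S k f A μ) (hgB : DerivBound w S k g B μ) :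
    DerivBound w S k (fun y => f y * g y) (2 ^ k * (A * B)) μ := by
  have key : ∀ y ∈ S, ‖f y * g y‖ ≤ A * B := fun y hy => by
    rw [norm_mul]
    exact mul_le_mul (hfA.norm_le y hy) (hgB.norm_le y hy) (norm_nonneg _) hA
  induction k generalizing f g A B with
  | zero => exact fun y hy => by simpa using key y hy
  | succ k ih =>
    refine ⟨fun y hy => (key y hy).trans (le_mul_of_one_le_left (mul_nonneg hA hB)
      (one_le_pow₀ one_le_two)), ?_⟩
    have h1 := ih (contDiffOn_fderiv_apply hU hf w) hg (mul_nonneg hA hμ) hB hfA.2 hgB.of_succ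
      (fun y hy => by
        rw [norm_mul]
        exact mul_le_mul (hfA.2.norm_le y hy) (hgB.norm_le y hy) (norm_nonneg _)
          (mul_nonneg hA hμ))
    have h2 := ih hf (contDiffOn_fderiv_apply hU hg w) hA (mul_nonneg hB hμ) hfA.of_succ hgB.2
      (fun y hy => by
        rw [norm_mul]
        exact mul_le_mul (hfA.norm_le y hy) (hgB.2.norm_le y hy) (norm_nonneg _) hA)
    have h3 := DerivBound.add hU hSU ((contDiffOn_fderiv_apply hU hf w).mul hg)
      (hf.mul (contDiffOn_fderiv_apply hU hg w)) h1 h2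
    have e : 2 ^ (k + 1) * (A * B) * μ = 2 ^ k * (A * μ * B) + 2 ^ k * (A * (B * μ)) := by ring
    rw [e]
    exact h3.congr hU hSU fun y hy => (fderiv_mul_apply (differentiableAt_of_contDiffOn hU hf hy)
      (differentiableAt_of_contDiffOn hU hg hy) w).symm

theorem DerivBound.const_zero {k : ℕ} {A μ : ℝ} (hA : 0 ≤ A) (hμ : 0 ≤ μ) :
    DerivBound w S k (fun _ => 0) A μ := by
  induction k generalizing A with
  | zero => intro y _; simpa using hA
  | succ k ih =>
    refine ⟨fun y _ => by simpa using hA, ?_⟩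
    simpa using! ih (mul_nonneg hA hμ)

theorem DerivBound.neg {k : ℕ} {f : E → ℂ} {A μ : ℝ} (h : DerivBound w S k f A μ) :
    DerivBound w S k (fun y => -f y) A μ := by
  induction k generalizing f A with
  | zero => exact fun y hy => by simpa using h y hy
  | succ k ih =>
    refine ⟨fun y hy => by simpa using h.1 y hy, ?_⟩
    simpa [fderiv_fun_neg] using ih h.2

theorem DerivBound.const {k : ℕ} {A μ : ℝ} {c : ℂ} (hA : ‖c‖ ≤ A) (hμ : 0 ≤ μ) :
    DerivBound w S k (fun _ => c) A μ := by
  cases k with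
  | zero => exact fun y _ => hA
  | succ k =>
    refine ⟨fun y _ => hA, ?_⟩
    simpa using DerivBound.const_zero (w := w) (S := S) (k := k)
      (mul_nonneg ((norm_nonneg _).trans hA) hμ) hμ

/-- Derivatives of the reciprocal of a function bounded below; the constant depends only on the
ratios of the bounds. -/
theorem DerivBound.exists_inv (k : ℕ) {c C : ℝ} (hc : 0 < c) (hC : 0 ≤ C) (w : E) :
    ∃ A : ℝ, 0 ≤ A ∧ ∀ (S U : Set E) (q : E → ℂ) (lam : ℝ), 0 < lam → IsOpen U → S ⊆ U →
      ContDiffOn ℝ ∞ q U → (∀ y ∈ U, q y ≠ 0) → (∀ y ∈ S, c * lam ≤ ‖q y‖) →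
      DerivBound w S k q (C * lam) 1 → DerivBound w S k (fun y => (q y)⁻¹) (A / lam) 1 := by
  have base : ∀ (S : Set E) (q : E → ℂ) (lam : ℝ), 0 < lam → (∀ y ∈ S, c * lam ≤ ‖q y‖) →
      ∀ y ∈ S, ‖(q y)⁻¹‖ ≤ c⁻¹ / lam := fun S q lam hl h y hy => by
    rw [norm_inv]
    calc ‖q y‖⁻¹ ≤ (c * lam)⁻¹ := inv_anti₀ (mul_pos hc hl) (h y hy)
      _ = c⁻¹ / lam := by rw [mul_inv, div_eq_mul_inv]
  induction k with
  | zero => exact ⟨c⁻¹, (inv_pos.2 hc).le, fun S U q lam hl _ _ _ _ h _ => base S q lam hl h⟩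
  | succ k ih =>
    obtain ⟨A, hA, ih⟩ := ih
    -- The first entry bounds `q⁻¹` itself. The second bounds its derivative `-q' · (q⁻¹ · q⁻¹)`,
    -- with one factor `2 ^ k` for each of the two products.
    refine ⟨max c⁻¹ (2 ^ k * (C * (2 ^ k * (A * A)))),
      (inv_pos.2 hc).le.trans (le_max_left _ _), fun S U q lam hl hU hSU hq hq0 hqc hqC => ?_⟩
    refine ⟨fun y hy => (base S q lam hl hqc y hy).trans ?_, ?_⟩
    · gcongr; exact le_max_left _ _
    have hinv : ContDiffOn ℝ ∞ (fun y => (q y)⁻¹) U := hq.inv hq0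
    have hD : ContDiffOn ℝ ∞ (fun y => -fderiv ℝ q y w) U := (contDiffOn_fderiv_apply hU hq w).neg
    have h1 := ih S U q lam hl hU hSU hq hq0 hqc hqC.of_succ
    have hAl : 0 ≤ A / lam := div_nonneg hA hl.le
    have h2 := DerivBound.mul hU hSU hinv hinv hAl hAl zero_le_one h1 h1
    have hCl : 0 ≤ C * lam := mul_nonneg hC hl.le
    have h3 : DerivBound w S k (fun y => -fderiv ℝ q y w) (C * lam) 1 := by
      simpa using hqC.2.neg
    have h4 := DerivBound.mul hU hSU hD (hinv.mul hinv) hCl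
      (mul_nonneg (by positivity) (mul_nonneg hAl hAl)) zero_le_one h3 h2
    have e : 2 ^ k * (C * lam * (2 ^ k * (A / lam * (A / lam))))
        = 2 ^ k * (C * (2 ^ k * (A * A))) / lam := by field_simp
    rw [e] at h4
    rw [mul_one]
    refine (h4.mono ?_ zero_le_one).congr hU hSU fun y hy => ?_
    · gcongr; exact le_max_right _ _
    -- The derivative of the reciprocal is found by differentiating `q · q⁻¹ = 1`, which holds near
    -- `y`.
    · have hm := fderiv_mul_apply (differentiableAt_of_contDiffOn hU hq hy)
        (differentiableAt_of_contDiffOn hU hinv hy) w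
      have h1 : (fun z => q z * (q z)⁻¹) =ᶠ[𝓝 y] fun _ => 1 := by
        filter_upwards [hU.mem_nhds hy] with z hz
        exact mul_inv_cancel₀ (hq0 z hz)
      rw [h1.fderiv_eq] at hm
      simp only [fderiv_fun_const, Pi.zero_apply, zero_apply] at hm
      have h2 := mul_inv_cancel₀ (hq0 y hy)
      linear_combination (q y)⁻¹ * hm + fderiv ℝ (fun y => (q y)⁻¹) y w * h2

end DerivBound

/-! ### Integration by parts and nonstationary phase -/

section NonstationaryPhase

theorem tsupport_mul_subset_of_left {X : Type*} [TopologicalSpace X] {b g : X → ℂ} :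
    tsupport (fun y => b y * g y) ⊆ tsupport b :=
  closure_mono (Function.support_mul_subset_left b g)

variable {E : Type*} [NormedAddCommGroup E] [NormedSpace ℝ E]

/-- Off the support of `b` the product vanishes near the point, so the values of `g` outside `U` are
irrelevant. This matters because nothing is known about the phase outside its cone. -/
theorem contDiff_mul_of_tsupport_subset {b g : E → ℂ} {U : Set E} (hb : ContDiff ℝ ∞ b)
    (hU : IsOpen U) (hbU : tsupport b ⊆ U) (hg : ContDiffOn ℝ ∞ g U) :
    ContDiff ℝ ∞ (fun y => b y * g y) := by
  rw [contDiff_iff_contDiffAt]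
  intro y
  by_cases hy : y ∈ tsupport b
  · exact hb.contDiffAt.mul (hg.contDiffAt (hU.mem_nhds (hbU hy)))
  · have : (fun z => b z * g z) =ᶠ[𝓝 y] fun _ => 0 := by
      filter_upwards [notMem_tsupport_iff_eventuallyEq.1 hy] with z hz
      simp [hz]
    exact contDiffAt_const.congr_of_eventuallyEq this

theorem contDiffOn_cexp {Φ : E → ℂ} {U : Set E} (hΦ : ContDiffOn ℝ ∞ Φ U) :
    ContDiffOn ℝ ∞ (fun y => Complex.exp (Complex.I * Φ y)) U :=
  (contDiffOn_const.mul hΦ).cexp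

theorem norm_cexp_I_mul_le_one {z : ℂ} (hz : 0 ≤ z.im) : ‖Complex.exp (Complex.I * z)‖ ≤ 1 := by
  rw [Complex.norm_exp]
  simpa using hz

variable [FiniteDimensional ℝ E] [MeasureSpace E] [BorelSpace E]
  [(volume : Measure E).IsAddHaarMeasure]

theorem integral_fderiv_apply_eq_zero {h : E → ℂ} (hh : ContDiff ℝ ∞ h)
    (hc : HasCompactSupport h) (w : E) : ∫ y, fderiv ℝ h y w = 0 := by
  have hd : Continuous fun y => fderiv ℝ h y w :=
    (hh.continuous_fderiv (by simp)).clm_apply continuous_const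
  have hdi : Integrable fun y => fderiv ℝ h y w :=
    hd.integrable_of_hasCompactSupport (hc.fderiv_apply (𝕜 := ℝ) w)
  have hi : Integrable h := hh.continuous.integrable_of_hasCompactSupport hc
  have := integral_mul_fderiv_eq_neg_fderiv_mul_of_integrable (μ := (volume : Measure E))
    (f := fun _ => (1 : ℂ)) (g := h) (v := w) (by simp) (by simpa using hdi)
    (by simpa using hi) (fun _ _ => differentiableAt_const _)
    (fun _ _ => hh.differentiable (by simp) _)
  simpa using this

/-- Integration by parts along `w` in an integral with a phase which is not stationary in the
direction `w`. -/
theorem integral_mul_exp_eq {b Φ : E → ℂ} {U : Set E} {w : E} (hU : IsOpen U)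
    (hb : ContDiff ℝ ∞ b) (hc : HasCompactSupport b) (hbU : tsupport b ⊆ U)
    (hΦ : ContDiffOn ℝ ∞ Φ U) (hD : ∀ y ∈ U, fderiv ℝ Φ y w ≠ 0) :
    ∫ y, b y * Complex.exp (Complex.I * Φ y) =
      ∫ y, -fderiv ℝ (fun z => b z * (Complex.I * fderiv ℝ Φ z w)⁻¹) y w *
        Complex.exp (Complex.I * Φ y) := by
  set g : E → ℂ := fun z => (Complex.I * fderiv ℝ Φ z w)⁻¹ with hg
  set e : E → ℂ := fun y => Complex.exp (Complex.I * Φ y) with he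
  have hI : ∀ y ∈ U, Complex.I * fderiv ℝ Φ y w ≠ 0 := fun y hy =>
    mul_ne_zero Complex.I_ne_zero (hD y hy)
  have hgU : ContDiffOn ℝ ∞ g U :=
    (contDiffOn_const.mul (contDiffOn_fderiv_apply hU hΦ w)).inv hI
  have heU : ContDiffOn ℝ ∞ e U := contDiffOn_cexp hΦ
  have hbg : ContDiff ℝ ∞ (fun z => b z * g z) := contDiff_mul_of_tsupport_subset hb hU hbU hgU
  have hbgs : tsupport (fun z => b z * g z) ⊆ tsupport b := tsupport_mul_subset_of_left
  have hh : ContDiff ℝ ∞ (fun z => b z * g z * e z) :=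
    contDiff_mul_of_tsupport_subset hbg hU (hbgs.trans hbU) heU
  have hbgc : HasCompactSupport (fun z => b z * g z) := hc.mul_right
  have hhc : HasCompactSupport (fun z => b z * g z * e z) := hbgc.mul_right
  have h0 := integral_fderiv_apply_eq_zero hh hhc w
  -- Since `g` is the reciprocal of `i ∂_w Φ`, the derivative falling on the exponential gives back
  -- `b e`.
  have hpt : ∀ y, fderiv ℝ (fun z => b z * g z * e z) y w =
      b y * e y - -fderiv ℝ (fun z => b z * g z) y w * e y := by
    intro y
    by_cases hy : y ∈ tsupport b
    · have hyU := hbU hy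
      rw [fderiv_mul_apply (hbg.differentiable (by simp) y)
        (differentiableAt_of_contDiffOn hU heU hyU)]
      have hde : fderiv ℝ e y w = Complex.I * fderiv ℝ Φ y w * e y := by
        have := (((differentiableAt_of_contDiffOn hU hΦ hyU).hasFDerivAt.const_mul
          Complex.I).cexp).fderiv
        rw [he, this]
        simp
        ring
      rw [hde]
      have : g y * (Complex.I * fderiv ℝ Φ y w) = 1 := inv_mul_cancel₀ (hI y hyU)
      linear_combination (b y * e y) * this
    · have hb0 : b y = 0 := image_eq_zero_of_notMem_tsupport hy
      have h1 : (fun z => b z * g z) =ᶠ[𝓝 y] fun _ => 0 := by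
        filter_upwards [notMem_tsupport_iff_eventuallyEq.1 hy] with z hz
        simp [hz]
      have h2 : (fun z => b z * g z * e z) =ᶠ[𝓝 y] fun _ => 0 := by
        filter_upwards [h1] with z hz
        simp [hz]
      rw [h2.fderiv_eq, h1.fderiv_eq, hb0]
      simp
  have hbe : ContDiff ℝ ∞ fun y => b y * e y := contDiff_mul_of_tsupport_subset hb hU hbU heU
  have i1 : Integrable fun y => b y * e y :=
    hbe.continuous.integrable_of_hasCompactSupport hc.mul_right
  have hdc : HasCompactSupport fun y => fderiv ℝ (fun z => b z * g z) y w :=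
    hbgc.fderiv_apply (𝕜 := ℝ) w
  have hds : ContDiff ℝ ∞ fun y => -fderiv ℝ (fun z => b z * g z) y w :=
    ((hbg.fderiv_right (m := ∞) (by simp)).clm_apply contDiff_const).neg
  have hdt : tsupport (fun y => -fderiv ℝ (fun z => b z * g z) y w) ⊆ U := by
    have : (fun y => -fderiv ℝ (fun z => b z * g z) y w) =
      -(fun y => fderiv ℝ (fun z => b z * g z) y w) := rfl
    rw [this, tsupport_neg]
    exact (tsupport_fderiv_apply_subset ℝ w).trans (hbgs.trans hbU)
  have i2 : Integrable fun y => -fderiv ℝ (fun z => b z * g z) y w * e y :=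
    (contDiff_mul_of_tsupport_subset hds hU hdt heU).continuous.integrable_of_hasCompactSupport
      (hdc.neg.mul_right)
  simp only [hpt] at h0
  rw [integral_sub i1 i2] at h0
  exact sub_eq_zero.1 h0

/-- Nonstationary phase with explicit constants. -/
theorem norm_integral_mul_exp_le (k : ℕ) {Φ : E → ℂ} {S U : Set E} {w : E} {G μ : ℝ}
    (hS : IsCompact S) (hU : IsOpen U) (hSU : S ⊆ U) (hΦ : ContDiffOn ℝ ∞ Φ U)
    (him : ∀ y ∈ S, 0 ≤ (Φ y).im) (hD : ∀ y ∈ U, fderiv ℝ Φ y w ≠ 0) (hG0 : 0 ≤ G)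
    (hμ : 1 ≤ μ) (hG : DerivBound w S k (fun y => (Complex.I * fderiv ℝ Φ y w)⁻¹) G 1)
    {b : E → ℂ} {B : ℝ} (hb : ContDiff ℝ ∞ b) (hbS : tsupport b ⊆ S) (hB0 : 0 ≤ B)
    (hB : DerivBound w S k b B μ) :
    ‖∫ y, b y * Complex.exp (Complex.I * Φ y)‖ ≤
      2 ^ (k * k) * (G * μ) ^ k * B * volume.real S := by
  induction k generalizing b B with
  | zero =>
    have h0 : ∫ y, b y * Complex.exp (Complex.I * Φ y) =
        ∫ y in S, b y * Complex.exp (Complex.I * Φ y) := by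
      refine (setIntegral_eq_integral_of_forall_compl_eq_zero fun y hy => ?_).symm
      rw [image_eq_zero_of_notMem_tsupport fun h => hy (hbS h), zero_mul]
    rw [h0]
    simp only [mul_zero, pow_zero, one_mul]
    refine norm_setIntegral_le_of_norm_le_const hS.measure_lt_top fun y hy => ?_
    rw [norm_mul]
    exact (mul_le_mul (hB y hy) (norm_cexp_I_mul_le_one (him y hy)) (norm_nonneg _) hB0).trans
      (mul_one B).le
  | succ k ih =>
    have hbU := hbS.trans hSU
    have hc : HasCompactSupport b := hS.of_isClosed_subset (isClosed_tsupport b) hbS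
    rw [integral_mul_exp_eq hU hb hc hbU hΦ hD]
    have hgU : ContDiffOn ℝ ∞ (fun y => (Complex.I * fderiv ℝ Φ y w)⁻¹) U :=
      (contDiffOn_const.mul (contDiffOn_fderiv_apply hU hΦ w)).inv
        fun y hy => mul_ne_zero Complex.I_ne_zero (hD y hy)
    have hbg := contDiff_mul_of_tsupport_subset hb hU hbU hgU
    have hμ0 : 0 ≤ μ := zero_le_one.trans hμ
    have hm := DerivBound.mul hU hSU hb.contDiffOn hgU hB0 hG0 hμ0 hB
      (hG.mono_scale hG0 zero_le_one hμ)
    -- The new amplitude `-∂_w(b g)` has one controlled derivative fewer, and its bound carries one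
    -- more factor `G μ`.
    refine (ih hG.of_succ ((hbg.fderiv_right (m := ∞) (by simp)).clm_apply contDiff_const).neg
      ?_ (by positivity) hm.2.neg).trans ?_
    · have : (fun y => -fderiv ℝ (fun z => b z * (Complex.I * fderiv ℝ Φ z w)⁻¹) y w) =
        -(fun y => fderiv ℝ (fun z => b z * (Complex.I * fderiv ℝ Φ z w)⁻¹) y w) := rfl
      rw [this, tsupport_neg]
      exact (tsupport_fderiv_apply_subset ℝ w).trans (tsupport_mul_subset_of_left.trans hbS)
    · have e : 2 ^ (k * k) * (G * μ) ^ k * (2 ^ (k + 1) * (B * G) * μ) * volume.real S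
          = 2 ^ (k * k + (k + 1)) * ((G * μ) ^ (k + 1) * B * volume.real S) := by
        rw [pow_add, pow_succ (G * μ)]; ring
      rw [e]
      -- The product rule contributes `2 ^ (k + 1)` in this step; the exponent `k * k` is chosen to
      -- absorb all such factors.
      have hp : (2 : ℝ) ^ (k * k + (k + 1)) ≤ 2 ^ ((k + 1) * (k + 1)) :=
        pow_le_pow_right₀ one_le_two (by nlinarith)
      simpa only [mul_assoc] using mul_le_mul_of_nonneg_right hp
        (show 0 ≤ (G * μ) ^ (k + 1) * B * volume.real S by positivity)

end NonstationaryPhase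

/-! ### Homogeneous functions on the conic support -/

section ConeSupport

variable {E F : Type*} [NormedAddCommGroup E] [NormedSpace ℝ E]
  [NormedAddCommGroup F] [NormedSpace ℝ F]

theorem mem_coneSupport_of_mem_tsupport {a : E × F → ℂ} {p : E × F} (hp : p ∈ tsupport a)
    (h0 : p.2 ≠ 0) : p ∈ coneSupport a :=
  ⟨subset_closure ⟨p, hp, h0, 1, one_pos, by simp⟩, h0⟩

theorem smul_mem_coneSupport {a : E × F → ℂ} {y : E} {θ : F} (hp : (y, θ) ∈ coneSupport a)
    {r : ℝ} (hr : 0 < r) : (y, r • θ) ∈ coneSupport a := by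
  refine ⟨?_, smul_ne_zero hr.ne' hp.2⟩
  have hc : Continuous fun p : E × F => (p.1, r • p.2) := by fun_prop
  refine map_mem_closure hc hp.1 (f := fun p : E × F => (p.1, r • p.2)) ?_
  rintro _ ⟨q, hq, hq0, s, hs, rfl⟩
  exact ⟨q, hq, hq0, r * s, mul_pos hr hs, by simp [mul_smul]⟩

/-- On the unit sphere the condition `θ ≠ 0` is automatic, so the relatively closed set may be
replaced by a closed one. This is the compactness behind all the homogeneous estimates. -/
theorem isCompact_coneSupport_inter [ProperSpace F] (a : E × F → ℂ) {K : Set E}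
    (hK : IsCompact K) : IsCompact (coneSupport a ∩ K ×ˢ Metric.sphere (0 : F) 1) := by
  have h : coneSupport a ∩ K ×ˢ Metric.sphere (0 : F) 1 =
      closure {p | ∃ q ∈ tsupport a, q.2 ≠ 0 ∧ ∃ r : ℝ, 0 < r ∧ p = (q.1, r • q.2)} ∩
        K ×ˢ Metric.sphere (0 : F) 1 := by
    ext p
    refine ⟨fun h => ⟨h.1.1, h.2⟩, fun h => ⟨⟨h.1, ?_⟩, h.2⟩⟩
    have h2 := h.2.2
    rintro (h0 : p.2 = 0)
    simp [h0] at h2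
  rw [h]
  exact (hK.prod (isCompact_sphere 0 1)).inter_left isClosed_closure

theorem isClosed_coneSupport_slice (a : E × F → ℂ) {θ : F} (hθ : θ ≠ 0) :
    IsClosed {y | (y, θ) ∈ coneSupport a} := by
  have : {y | (y, θ) ∈ coneSupport a} = (fun y => (y, θ)) ⁻¹' closure
      {p | ∃ q ∈ tsupport a, q.2 ≠ 0 ∧ ∃ r : ℝ, 0 < r ∧ p = (q.1, r • q.2)} := by
    ext y
    exact ⟨fun h => h.1, fun h => ⟨h, hθ⟩⟩
  rw [this]
  exact isClosed_closure.preimage (by fun_prop)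

theorem normalize_mem_coneSupport {a : E × F → ℂ} {y : E} {θ : F}
    (hp : (y, θ) ∈ coneSupport a) {K : Set E} (hy : y ∈ K) :
    (y, ‖θ‖⁻¹ • θ) ∈ coneSupport a ∩ K ×ˢ Metric.sphere (0 : F) 1 := by
  have h0 : 0 < ‖θ‖ := norm_pos_iff.2 hp.2
  refine ⟨smul_mem_coneSupport hp (inv_pos.2 h0), hy, ?_⟩
  simp [norm_smul, h0.ne']

/-- Smooth functions on the cone `Γ` which are positively homogeneous of degree `d`. -/
structure IsHomogeneousOn (Γ : Set (E × F)) (d : ℕ) (s : E × F → ℂ) : Prop where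
  contDiffOn : ContDiffOn ℝ ∞ s Γ
  map_smul : ∀ p ∈ Γ, ∀ r : ℝ, 0 < r → s (p.1, r • p.2) = (r : ℂ) ^ d * s p

theorem IsPhaseFunction.isHomogeneousOn {Γ : Set (E × F)} {φ : E × F → ℂ}
    (h : IsPhaseFunction Γ φ) : IsHomogeneousOn Γ 1 φ :=
  ⟨h.contDiffOn, fun p hp r hr => by simpa using h.homogeneous p hp r hr⟩

variable {Γ : Set (E × F)} {s : E × F → ℂ}

theorem IsHomogeneousOn.norm_eq {d : ℕ} (hs : IsHomogeneousOn Γ d s) {a : E × F → ℂ}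
    (hcs : coneSupport a ⊆ Γ) {y : E} {θ : F} (hp : (y, θ) ∈ coneSupport a) :
    ‖s (y, θ)‖ = ‖s (y, ‖θ‖⁻¹ • θ)‖ * ‖θ‖ ^ d := by
  have h0 : 0 < ‖θ‖ := norm_pos_iff.2 hp.2
  have := hs.map_smul _ (hcs (smul_mem_coneSupport hp (inv_pos.2 h0))) _ h0
  simp only [smul_smul, mul_inv_cancel₀ h0.ne', one_smul] at this
  rw [this]
  simp [mul_comm]

theorem IsHomogeneousOn.exists_norm_le [ProperSpace F] {d : ℕ} (hs : IsHomogeneousOn Γ d s)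
    {a : E × F → ℂ} (hcs : coneSupport a ⊆ Γ) {K : Set E} (hK : IsCompact K) :
    ∃ C : ℝ, 0 ≤ C ∧ ∀ y ∈ K, ∀ θ, (y, θ) ∈ coneSupport a → ‖s (y, θ)‖ ≤ C * ‖θ‖ ^ d := by
  obtain ⟨C, hC⟩ := (isCompact_coneSupport_inter a hK).exists_bound_of_continuousOn
    (hs.contDiffOn.continuousOn.mono (Set.inter_subset_left.trans hcs))
  refine ⟨max C 0, le_max_right _ _, fun y hy θ hp => ?_⟩
  rw [hs.norm_eq hcs hp]
  gcongr
  exact (hC _ (normalize_mem_coneSupport hp hy)).trans (le_max_left _ _)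

theorem IsHomogeneousOn.exists_le_norm [ProperSpace F] {d : ℕ} (hs : IsHomogeneousOn Γ d s)
    {a : E × F → ℂ} (hcs : coneSupport a ⊆ Γ) {K : Set E} (hK : IsCompact K)
    (h0 : ∀ y ∈ K, ∀ θ, (y, θ) ∈ coneSupport a → s (y, θ) ≠ 0) :
    ∃ c : ℝ, 0 < c ∧ ∀ y ∈ K, ∀ θ, (y, θ) ∈ coneSupport a → c * ‖θ‖ ^ d ≤ ‖s (y, θ)‖ := by
  obtain ⟨c, hc, h⟩ := (isCompact_coneSupport_inter a hK).exists_forall_le' (f := fun p => ‖s p‖)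
    (a := 0) (hs.contDiffOn.continuousOn.mono (Set.inter_subset_left.trans hcs)).norm
    fun p hp => norm_pos_iff.2 (h0 p.1 hp.2.1 p.2 hp.1)
  refine ⟨c, hc, fun y hy θ hp => ?_⟩
  rw [hs.norm_eq hcs hp]
  gcongr
  exact h _ (normalize_mem_coneSupport hp hy)

theorem hasFDerivAt_slice (hΓ : IsOpen Γ) (hs : ContDiffOn ℝ ∞ s Γ) {y : E} {θ : F}
    (hp : (y, θ) ∈ Γ) :
    HasFDerivAt (fun z => s (z, θ)) ((fderiv ℝ s (y, θ)).comp (.inl ℝ E F)) y :=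
  ((differentiableAt_of_contDiffOn hΓ hs hp).hasFDerivAt).comp y (hasFDerivAt_prodMk_left y θ)

theorem fderiv_slice_apply (hΓ : IsOpen Γ) (hs : ContDiffOn ℝ ∞ s Γ) {y : E} {θ : F}
    (hp : (y, θ) ∈ Γ) (w : E) :
    fderiv ℝ (fun z => s (z, θ)) y w = fderiv ℝ s (y, θ) (w, 0) := by
  rw [(hasFDerivAt_slice hΓ hs hp).fderiv]
  simp

theorem isOpen_slice (hΓ : IsOpen Γ) (θ : F) : IsOpen {y : E | (y, θ) ∈ Γ} :=
  hΓ.preimage (by fun_prop)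

theorem contDiffOn_slice (hs : ContDiffOn ℝ ∞ s Γ) (θ : F) :
    ContDiffOn ℝ ∞ (fun y => s (y, θ)) {y | (y, θ) ∈ Γ} :=
  hs.comp (contDiff_prodMk_left θ).contDiffOn fun _ h => h

/-- Differentiation in the base variable commutes with dilations of `θ`, so the degree does not
drop. -/
theorem IsHomogeneousOn.fderiv_apply {d : ℕ} (hΓ : IsOpen Γ) (hc : IsConic Γ)
    (hs : IsHomogeneousOn Γ d s) (w : E) :
    IsHomogeneousOn Γ d (fun p => fderiv ℝ s p (w, 0)) := by
  refine ⟨contDiffOn_fderiv_apply hΓ hs.contDiffOn _, ?_⟩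
  rintro ⟨y, θ⟩ hp r hr
  have hp' := hc _ hp r hr
  rw [← fderiv_slice_apply hΓ hs.contDiffOn hp', ← fderiv_slice_apply hΓ hs.contDiffOn hp]
  have : (fun z => s (z, r • θ)) =ᶠ[𝓝 y] fun z => (r : ℂ) ^ d * s (z, θ) := by
    filter_upwards [(isOpen_slice hΓ θ).mem_nhds hp] with z hz
    exact hs.map_smul _ hz r hr
  rw [this.fderiv_eq, fderiv_const_mul (hasFDerivAt_slice hΓ hs.contDiffOn hp).differentiableAt]
  simp

theorem IsHomogeneousOn.mul {d e : ℕ} {t : E × F → ℂ} (hs : IsHomogeneousOn Γ d s)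
    (ht : IsHomogeneousOn Γ e t) : IsHomogeneousOn Γ (d + e) (fun p => s p * t p) :=
  ⟨hs.contDiffOn.mul ht.contDiffOn, fun p hp r hr => by
    rw [hs.map_smul p hp r hr, ht.map_smul p hp r hr]; ring⟩

theorem IsHomogeneousOn.const_mul {d : ℕ} (c : ℂ) (hs : IsHomogeneousOn Γ d s) :
    IsHomogeneousOn Γ d (fun p => c * s p) :=
  ⟨contDiffOn_const.mul hs.contDiffOn, fun p hp r hr => by
    rw [hs.map_smul p hp r hr]; ring⟩

theorem IsHomogeneousOn.exists_derivBound [ProperSpace F] {d : ℕ} (hΓ : IsOpen Γ)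
    (hc : IsConic Γ) (hs : IsHomogeneousOn Γ d s) {a : E × F → ℂ} (hcs : coneSupport a ⊆ Γ)
    {K : Set E} (hK : IsCompact K) (w : E) (k : ℕ) :
    ∃ C : ℝ, 0 ≤ C ∧ ∀ θ : F, DerivBound w {y | y ∈ K ∧ (y, θ) ∈ coneSupport a} k
      (fun y => s (y, θ)) (C * ‖θ‖ ^ d) 1 := by
  induction k generalizing s with
  | zero =>
    obtain ⟨C, hC, h⟩ := hs.exists_norm_le hcs hK
    exact ⟨C, hC, fun θ y hy => h y hy.1 θ hy.2⟩
  | succ k ih =>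
    obtain ⟨C, hC, h⟩ := hs.exists_norm_le hcs hK
    obtain ⟨C', hC', h'⟩ := ih (hs.fderiv_apply hΓ hc w)
    refine ⟨max C C', hC.trans (le_max_left _ _), fun θ => ⟨fun y hy => ?_, ?_⟩⟩
    · refine (h y hy.1 θ hy.2).trans ?_
      gcongr
      exact le_max_left _ _
    · refine ((h' θ).congr (isOpen_slice hΓ θ) (fun y hy => hcs hy.2) fun y hy =>
        (fderiv_slice_apply hΓ hs.contDiffOn hy w).symm).mono ?_ zero_le_one
      rw [mul_one]
      gcongr
      exact le_max_right _ _

end ConeSupport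

/-! ### Symbol estimates as directional derivative bounds -/

section Symbol

variable {E F : Type*} [NormedAddCommGroup E] [NormedSpace ℝ E]
  [NormedAddCommGroup F] [NormedSpace ℝ F]

theorem derivBound_of_norm_iteratedFDeriv_le {w : E} {S : Set E} {k : ℕ} {f : E → ℂ} {A μ : ℝ}
    (hf : ContDiff ℝ ∞ f)
    (h : ∀ j ≤ k, ∀ y ∈ S, ‖iteratedFDeriv ℝ j f y‖ * ‖w‖ ^ j ≤ A * μ ^ j) :
    DerivBound w S k f A μ := by
  have h0 : ∀ y ∈ S, ‖f y‖ ≤ A := fun y hy => by simpa using h 0 (Nat.zero_le _) y hy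
  induction k generalizing f A with
  | zero => exact h0
  | succ k ih =>
    have h1 : ∀ j ≤ k, ∀ y ∈ S,
        ‖iteratedFDeriv ℝ j (fun y => fderiv ℝ f y w) y‖ * ‖w‖ ^ j ≤ A * μ * μ ^ j := by
      intro j hj y hy
      have h2 : ‖iteratedFDeriv ℝ j (fun y => fderiv ℝ f y w) y‖ ≤
          ‖w‖ * ‖iteratedFDeriv ℝ (j + 1) f y‖ := by
        rw [← norm_iteratedFDeriv_fderiv]
        exact norm_iteratedFDeriv_clm_apply_const
          ((hf.fderiv_right (m := ∞) (by simp)).contDiffAt) (by exact_mod_cast le_top)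
      calc _ ≤ ‖w‖ * ‖iteratedFDeriv ℝ (j + 1) f y‖ * ‖w‖ ^ j := by gcongr
        _ = ‖iteratedFDeriv ℝ (j + 1) f y‖ * ‖w‖ ^ (j + 1) := by ring
        _ ≤ A * μ ^ (j + 1) := h (j + 1) (by omega) y hy
        _ = A * μ * μ ^ j := by ring
    exact ⟨h0, ih ((hf.fderiv_right (m := ∞) (by simp)).clm_apply contDiff_const) h1
      fun y hy => by simpa using h1 0 (Nat.zero_le _) y hy⟩

/-- Integrations by parts take place in the base variable only, so the symbol estimates are read off
at order zero in `θ`. Each base derivative then costs a factor `(1 + ‖θ‖) ^ δ`, which becomes the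
scale `μ` of `DerivBound`. -/
theorem IsSymbol.norm_iteratedFDeriv_le {m ρ δ : ℝ} {a : E × F → ℂ} (ha : IsSymbol m ρ δ a)
    {K : Set E} (hK : IsCompact K) (j : ℕ) : ∃ C : ℝ, 0 ≤ C ∧ ∀ y ∈ K, ∀ θ : F,
      ‖iteratedFDeriv ℝ j (fun z => a (z, θ)) y‖ ≤
        C * ((1 + ‖θ‖) ^ m * ((1 + ‖θ‖) ^ δ) ^ j) := by
  obtain ⟨C, hC⟩ := ha.2 K hK 0 j
  refine ⟨max C 0, le_max_right _ _, fun y hy θ => ?_⟩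
  have h := hC y hy θ
  have e : (fun y' => iteratedFDeriv ℝ 0 (fun θ' => a (y', θ')) θ) =
      (continuousMultilinearCurryFin0 ℝ F ℂ).symm ∘ fun z => a (z, θ) := by
    ext z; simp [iteratedFDeriv_zero_eq_comp]
  rw [e, LinearIsometryEquiv.norm_iteratedFDeriv_comp_left] at h
  have hp : 0 < 1 + ‖θ‖ := by positivity
  have e2 : (1 + ‖θ‖) ^ (m - ρ * (0 : ℕ) + δ * j) = (1 + ‖θ‖) ^ m * ((1 + ‖θ‖) ^ δ) ^ j := by
    rw [Nat.cast_zero, mul_zero, sub_zero, Real.rpow_add hp, Real.rpow_mul hp.le,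
      Real.rpow_natCast]
  rw [e2] at h
  refine h.trans ?_
  gcongr
  exact le_max_left _ _

theorem IsSymbol.exists_derivBound {m ρ δ : ℝ} {a : E × F → ℂ} (ha : IsSymbol m ρ δ a)
    {K : Set E} (hK : IsCompact K) (w : E) (k : ℕ) : ∃ A : ℝ, 0 ≤ A ∧ ∀ θ : F,
      DerivBound w K k (fun y => a (y, θ)) (A * (1 + ‖θ‖) ^ m) ((1 + ‖θ‖) ^ δ) := by
  choose C hC0 hC using fun j => ha.norm_iteratedFDeriv_le hK j
  refine ⟨∑ j ∈ Finset.range (k + 1), C j * ‖w‖ ^ j,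
    Finset.sum_nonneg fun j _ => mul_nonneg (hC0 j) (by positivity), fun θ => ?_⟩
  refine derivBound_of_norm_iteratedFDeriv_le (ha.1.comp (contDiff_prodMk_left θ))
    fun j hj y hy => ?_
  calc ‖iteratedFDeriv ℝ j (fun z => a (z, θ)) y‖ * ‖w‖ ^ j
      ≤ C j * ((1 + ‖θ‖) ^ m * ((1 + ‖θ‖) ^ δ) ^ j) * ‖w‖ ^ j := by
        gcongr; exact hC j y hy θ
    _ = C j * ‖w‖ ^ j * ((1 + ‖θ‖) ^ m * ((1 + ‖θ‖) ^ δ) ^ j) := by ring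
    _ ≤ (∑ j ∈ Finset.range (k + 1), C j * ‖w‖ ^ j) *
        ((1 + ‖θ‖) ^ m * ((1 + ‖θ‖) ^ δ) ^ j) := by
        refine mul_le_mul_of_nonneg_right ?_ (by positivity)
        exact Finset.single_le_sum (f := fun j => C j * ‖w‖ ^ j)
          (fun j _ => mul_nonneg (hC0 j) (by positivity)) (Finset.mem_range.2 (by omega))
    _ = _ := by ring

theorem derivBound_ofReal {w : E} {S : Set E} {k : ℕ} {ψ : E → ℝ} {P : ℝ}
    (hψ : ContDiff ℝ ∞ ψ) (hP : ∀ j ≤ k, ∀ y ∈ S, ‖iteratedFDeriv ℝ j ψ y‖ ≤ P) (hP0 : 0 ≤ P) :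
    DerivBound w S k (fun y => (ψ y : ℂ)) (P * (1 + ‖w‖) ^ k) 1 := by
  refine derivBound_of_norm_iteratedFDeriv_le (Complex.ofRealCLM.contDiff.comp hψ)
    fun j hj y hy => ?_
  have : ‖iteratedFDeriv ℝ j (fun y => (ψ y : ℂ)) y‖ = ‖iteratedFDeriv ℝ j ψ y‖ :=
    Complex.ofRealLI.norm_iteratedFDeriv_comp_left hψ.contDiffAt (by exact_mod_cast le_top)
  rw [this, one_pow, mul_one]
  have hw : ‖w‖ ^ j ≤ (1 + ‖w‖) ^ k :=
    (pow_le_pow_left₀ (norm_nonneg _) (by linarith) j).trans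
      (pow_le_pow_right₀ (by linarith [norm_nonneg w]) hj)
  exact mul_le_mul (hP j hj y hy) hw (by positivity) hP0

end Symbol

/-! ### Rapid decrease of the integral over the base -/

section FiberIntegral

variable {E F : Type*} [NormedAddCommGroup E] [NormedSpace ℝ E]
  [NormedAddCommGroup F] [NormedSpace ℝ F]

theorem mem_of_mem_tsupport {Γ : Set (E × F)} {a : E × F → ℂ} (hcs : coneSupport a ⊆ Γ)
    {p : E × F} (hp : p ∈ tsupport a) (h0 : p.2 ≠ 0) : p ∈ Γ :=
  hcs (mem_coneSupport_of_mem_tsupport hp h0)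

theorem isOpen_snd_ne_zero : IsOpen {p : E × F | p.2 ≠ 0} :=
  isOpen_ne.preimage continuous_snd

theorem contDiffOn_mul_of_coneSupport_subset {Γ : Set (E × F)} {a b g : E × F → ℂ}
    (hΓ : IsOpen Γ) (hcs : coneSupport a ⊆ Γ) (hb : ContDiff ℝ ∞ b)
    (hba : tsupport b ⊆ tsupport a) (hg : ContDiffOn ℝ ∞ g Γ) :
    ContDiffOn ℝ ∞ (fun p => b p * g p) {p | p.2 ≠ 0} := by
  intro p hp
  refine ContDiffAt.contDiffWithinAt ?_
  by_cases hpa : p ∈ tsupport b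
  · exact hb.contDiffAt.mul
      (hg.contDiffAt (hΓ.mem_nhds (mem_of_mem_tsupport hcs (hba hpa) hp)))
  · have : (fun z => b z * g z) =ᶠ[𝓝 p] fun _ => 0 := by
      filter_upwards [notMem_tsupport_iff_eventuallyEq.1 hpa] with z hz
      simp [hz]
    exact contDiffAt_const.congr_of_eventuallyEq this

/-- The integrand `a e^{iφ}` of an oscillatory integral. -/
def integrand (φ a : E × F → ℂ) (p : E × F) : ℂ := a p * Complex.exp (Complex.I * φ p)

theorem contDiffOn_integrand {Γ : Set (E × F)} {φ a : E × F → ℂ} (hφ : IsPhaseFunction Γ φ)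
    (hcs : coneSupport a ⊆ Γ) (ha : ContDiff ℝ ∞ a) :
    ContDiffOn ℝ ∞ (integrand φ a) {p | p.2 ≠ 0} :=
  contDiffOn_mul_of_coneSupport_subset hφ.isOpen hcs ha subset_rfl
    (contDiffOn_cexp hφ.contDiffOn)

theorem norm_integrand_le {Γ : Set (E × F)} {φ a : E × F → ℂ} (hφ : IsPhaseFunction Γ φ)
    (hcs : coneSupport a ⊆ Γ) {p : E × F} (hp : p.2 ≠ 0) : ‖integrand φ a p‖ ≤ ‖a p‖ := by
  rw [integrand, norm_mul]
  by_cases hpa : p ∈ tsupport a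
  · exact mul_le_of_le_one_right (norm_nonneg _)
      (norm_cexp_I_mul_le_one (hφ.im_nonneg p (mem_of_mem_tsupport hcs hpa hp)))
  · simp [image_eq_zero_of_notMem_tsupport hpa]

/-- The integral of `a e^{iφ} ψ` over `y` for fixed `θ`. -/
def fiberIntegral [MeasureSpace E] (φ a : E × F → ℂ) (ψ : E → ℂ) (θ : F) : ℂ :=
  ∫ y, integrand φ a (y, θ) * ψ y

/-- Counting powers: of the `k` factors `1 + lam` gained by integrating by parts, `M` pay for the
weight in `ℓ`. The other `k - M` are spent on `θ` and leave the exponent `m + δ k - (k - M) ≤ -r`.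
-/
theorem one_add_pow_mul_rpow_le {m δ r lam L T : ℝ} {k M : ℕ} (hMk : M ≤ k)
    (hk : m + M + r ≤ k * (1 - δ)) (hT : 0 ≤ T) (hL : 0 ≤ L) (hlam : lam = T + L) :
    (1 + L) ^ M * ((1 + T) ^ m * ((1 + T) ^ δ) ^ k) ≤ (1 + lam) ^ k * (1 + T) ^ (-r) := by
  have hT1 : 0 < 1 + T := by linarith
  obtain ⟨j, rfl⟩ := Nat.exists_eq_add_of_le hMk
  have h1 : (1 + L) ^ M * (1 + T) ^ j ≤ (1 + lam) ^ (M + j) := by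
    rw [pow_add]
    have h0 : 0 ≤ 1 + L := by linarith
    have h1 : 0 ≤ 1 + lam := by linarith
    gcongr <;> linarith
  have h2 : (1 + T) ^ m * ((1 + T) ^ δ) ^ (M + j) ≤ (1 + T) ^ j * (1 + T) ^ (-r) := by
    rw [← Real.rpow_natCast, ← Real.rpow_mul hT1.le, ← Real.rpow_natCast, ← Real.rpow_add hT1,
      ← Real.rpow_add hT1]
    refine Real.rpow_le_rpow_of_exponent_le (by linarith) ?_
    push_cast at hk ⊢
    nlinarith
  have hr : 0 ≤ (1 + T) ^ (-r) := by positivity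
  calc (1 + L) ^ M * ((1 + T) ^ m * ((1 + T) ^ δ) ^ (M + j))
      ≤ (1 + L) ^ M * ((1 + T) ^ j * (1 + T) ^ (-r)) := by gcongr
    _ = (1 + L) ^ M * (1 + T) ^ j * (1 + T) ^ (-r) := by ring
    _ ≤ _ := mul_le_mul_of_nonneg_right h1 hr

variable [FiniteDimensional ℝ E] [MeasureSpace E] [BorelSpace E]
  [(volume : Measure E).IsAddHaarMeasure] [ProperSpace F]

/-- Rapid decrease in `(θ, ℓ)` of the integral of `a e^{i(φ-ℓ)} ψ` over `y`, for those `(θ, ℓ)` for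
which the derivative of `φ - ℓ` in the direction `w` has the size of `|θ| + |ℓ|`. -/
theorem exists_fiberIntegral_le {Γ : Set (E × F)} {φ a : E × F → ℂ} {m ρ δ : ℝ}
    (hφ : IsPhaseFunction Γ φ) (hcs : coneSupport a ⊆ Γ) (ha : IsSymbol m ρ δ a)
    (hδ₀ : 0 ≤ δ) (hδ₁ : δ < 1) (w : E) {K : Set E} (hK : IsCompact K) {c : ℝ} (hc : 0 < c)
    (M : ℕ) (r : ℝ) :
    ∃ (k : ℕ) (B : ℝ), 0 ≤ B ∧ ∀ (θ : F) (l : E →L[ℝ] ℝ), θ ≠ 0 →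
      (∀ y ∈ K, (y, θ) ∈ coneSupport a →
        c * (‖θ‖ + ‖l‖) ≤ ‖fderiv ℝ φ (y, θ) (w, 0) - l w‖) →
      ∀ ψ : E → ℝ, ContDiff ℝ ∞ ψ → tsupport ψ ⊆ K → ∀ P : ℝ, 0 ≤ P →
        (∀ j ≤ k, ∀ y ∈ K, ‖iteratedFDeriv ℝ j ψ y‖ ≤ P) →
        (1 + ‖l‖) ^ M *
          ‖fiberIntegral φ a (fun y => (ψ y : ℂ) * Complex.exp (-Complex.I * (l y : ℂ))) θ‖
            ≤ B * P * (1 + ‖θ‖) ^ (-r) := by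
  -- Such a number of integrations by parts exists because `δ < 1`.
  obtain ⟨k, hMk, hk⟩ : ∃ k : ℕ, M ≤ k ∧ m + M + r ≤ k * (1 - δ) := by
    obtain ⟨k₀, hk₀⟩ := exists_nat_ge ((m + M + r) / (1 - δ))
    refine ⟨max k₀ M, le_max_right _ _, ?_⟩
    have h1 : 0 < 1 - δ := by linarith
    rw [← div_le_iff₀ h1]
    exact hk₀.trans (by exact_mod_cast le_max_left _ _)
  obtain ⟨A, hA, hAb⟩ := ha.exists_derivBound hK w k
  obtain ⟨C₁, hC₁, hC₁b⟩ :=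
    (hφ.isHomogeneousOn.fderiv_apply hφ.isOpen hφ.isConic w).exists_derivBound hφ.isOpen hφ.isConic
      hcs hK w k
  -- `C₁` comes from `∂_w φ`, `‖w‖` from the constant `ℓ(w)`, and `2 ^ k` from treating
  -- multiplication by `i` with the product rule.
  set C : ℝ := 2 ^ k * (C₁ + ‖w‖) with hCdef
  have hC : 0 ≤ C := by positivity
  obtain ⟨D, hD, hDinv⟩ := DerivBound.exists_inv k hc hC w
  set W : ℝ := (1 + ‖w‖) ^ k with hW
  have hW0 : 0 ≤ W := by positivity
  set B : ℝ := 2 ^ k * (2 ^ (k * k) * D ^ k + 1) * (2 ^ k * (A * W)) * volume.real K with hB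
  refine ⟨k, B, by positivity, fun θ l hθ hnd ψ hψ hψK P hP0 hP => ?_⟩
  set T := ‖θ‖ with hT
  set L := ‖l‖ with hL
  have hT0 : 0 < T := norm_pos_iff.2 hθ
  have hL0 : 0 ≤ L := norm_nonneg _
  set lam := T + L with hlam
  have hlam0 : 0 < lam := by linarith
  set μ := (1 + T) ^ δ with hμ
  have hμ1 : 1 ≤ μ := Real.one_le_rpow (by linarith) hδ₀
  set Φ : E → ℂ := fun y => φ (y, θ) - (l y : ℂ) with hΦ
  set S : Set E := {y | y ∈ K ∧ (y, θ) ∈ coneSupport a} with hS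
  set U₀ : Set E := {y | (y, θ) ∈ Γ} with hU₀
  have hU₀o : IsOpen U₀ := isOpen_slice hφ.isOpen θ
  have hl : ContDiff ℝ ∞ fun y => (l y : ℂ) := Complex.ofRealCLM.contDiff.comp l.contDiff
  have hΦU₀ : ContDiffOn ℝ ∞ Φ U₀ := (contDiffOn_slice hφ.contDiffOn θ).sub hl.contDiffOn
  have hDΦ : ∀ y ∈ U₀, fderiv ℝ Φ y w = fderiv ℝ φ (y, θ) (w, 0) - l w := by
    intro y hy
    rw [hΦ, fderiv_fun_sub (hasFDerivAt_slice hφ.isOpen hφ.contDiffOn hy).differentiableAt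
      (hl.differentiable (by simp) y)]
    have : HasFDerivAt (fun y => (l y : ℂ)) (Complex.ofRealCLM.comp l) y :=
      Complex.ofRealCLM.hasFDerivAt.comp y l.hasFDerivAt
    rw [this.fderiv]
    simp [fderiv_slice_apply hφ.isOpen hφ.contDiffOn hy]
  -- The lower bound holds only on `S`; an open neighbourhood on which the derivative does not
  -- vanish is needed for the reciprocal to be smooth.
  set U : Set E := U₀ ∩ {y | fderiv ℝ Φ y w ≠ 0} with hU
  have hUo : IsOpen U :=
    (contDiffOn_fderiv_apply hU₀o hΦU₀ w).continuousOn.isOpen_inter_preimage hU₀o isOpen_ne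
  have hUU₀ : U ⊆ U₀ := Set.inter_subset_left
  have hSU₀ : S ⊆ U₀ := fun y hy => hcs hy.2
  have hlow : ∀ y ∈ S, c * lam ≤ ‖fderiv ℝ Φ y w‖ := fun y hy => by
    rw [hDΦ y (hSU₀ hy)]; exact hnd y hy.1 hy.2
  have hSU : S ⊆ U := fun y hy => ⟨hSU₀ hy, by
    have := (mul_pos hc hlam0).trans_le (hlow y hy)
    exact norm_pos_iff.1 this⟩
  have hSc : IsCompact S := hK.inter_right (isClosed_coneSupport_slice a hθ)
  have hΦU : ContDiffOn ℝ ∞ Φ U := hΦU₀.mono hUU₀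
  have him : ∀ y ∈ S, 0 ≤ (Φ y).im := fun y hy => by
    simpa [hΦ] using hφ.im_nonneg _ (hcs hy.2)
  -- the reciprocal of the derivative of the phase
  have hq : DerivBound w S k (fun y => Complex.I * fderiv ℝ Φ y w) (C * lam) 1 := by
    have h1 := hC₁b θ
    rw [pow_one] at h1
    have h2 : DerivBound w S k (fun _ => -(l w : ℂ)) (‖w‖ * L) 1 :=
      DerivBound.const (by
        rw [norm_neg, Complex.norm_real, mul_comm]; exact l.le_opNorm w) zero_le_one
    have h3 := DerivBound.add hU₀o hSU₀
      (contDiffOn_slice (contDiffOn_fderiv_apply hφ.isOpen hφ.contDiffOn (w, 0)) θ)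
      contDiffOn_const h1 h2
    have h4 := DerivBound.mul hU₀o hSU₀ contDiffOn_const
      ((contDiffOn_slice (contDiffOn_fderiv_apply hφ.isOpen hφ.contDiffOn (w, 0)) θ).add
        contDiffOn_const) zero_le_one
      (by positivity) zero_le_one (DerivBound.const (c := Complex.I) (by simp) zero_le_one) h3
    refine (h4.mono ?_ zero_le_one).congr hU₀o hSU₀ fun y hy => ?_
    · rw [hCdef, one_mul, mul_assoc]
      gcongr
      nlinarith [norm_nonneg w, hT0.le]
    · simp only [hDΦ y hy, sub_eq_add_neg]
  have hG := hDinv S U _ lam hlam0 hUo hSU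
    (contDiffOn_const.mul (contDiffOn_fderiv_apply hUo hΦU w))
    (fun y hy => mul_ne_zero Complex.I_ne_zero hy.2)
    (fun y hy => by simpa using hlow y hy) hq
  -- the amplitude
  set b : E → ℂ := fun y => a (y, θ) * (ψ y : ℂ) with hb
  have hψc : ContDiff ℝ ∞ fun y => (ψ y : ℂ) := Complex.ofRealCLM.contDiff.comp hψ
  have haθ : ContDiff ℝ ∞ fun y => a (y, θ) := ha.1.comp (contDiff_prodMk_left θ)
  have hbs : ContDiff ℝ ∞ b := haθ.mul hψc
  have hbS : tsupport b ⊆ S := by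
    refine closure_minimal (fun y hy => ?_) hSc.isClosed
    rw [Function.mem_support, hb, mul_ne_zero_iff, Complex.ofReal_ne_zero] at hy
    exact ⟨hψK (subset_closure hy.2),
      mem_coneSupport_of_mem_tsupport (subset_closure hy.1) hθ⟩
  have hSK : S ⊆ K := fun y hy => hy.1
  have hbB : DerivBound w S k b (2 ^ k * (A * (1 + T) ^ m * (P * W))) μ := by
    have h1 : DerivBound w K k b (2 ^ k * (A * (1 + T) ^ m * (P * W))) μ :=
      DerivBound.mul isOpen_univ (Set.subset_univ K) haθ.contDiffOn hψc.contDiffOn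
        (by positivity) (by positivity) (by positivity) (hAb θ)
        ((derivBound_ofReal hψ hP hP0).mono_scale (by positivity) zero_le_one hμ1)
    have hsub : ∀ (j : ℕ) (f : E → ℂ) (X : ℝ), DerivBound w K j f X μ → DerivBound w S j f X μ := by
      intro j
      induction j with
      | zero => exact fun f X h y hy => h y (hSK hy)
      | succ j ih => exact fun f X h => ⟨fun y hy => h.1 y (hSK hy), ih _ _ h.2⟩
    exact hsub _ _ _ h1
  set B₀ : ℝ := 2 ^ k * (A * (1 + T) ^ m * (P * W)) with hB₀
  have hB₀0 : 0 ≤ B₀ := by positivity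
  have hJ : fiberIntegral φ a (fun y => (ψ y : ℂ) * Complex.exp (-Complex.I * (l y : ℂ))) θ =
      ∫ y, b y * Complex.exp (Complex.I * Φ y) := by
    refine integral_congr_ae (ae_of_all _ fun y => ?_)
    simp only [integrand, hb, hΦ, mul_sub, Complex.exp_sub, neg_mul, Complex.exp_neg]
    ring
  have hvol : volume.real S ≤ volume.real K := measureReal_mono hSK hK.measure_lt_top.ne
  have hDl : 0 ≤ D / lam := div_nonneg hD hlam0.le
  have e0 : ‖∫ y, b y * Complex.exp (Complex.I * Φ y)‖ ≤ B₀ * volume.real K := by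
    have := norm_integral_mul_exp_le 0 hSc hUo hSU hΦU him (fun y hy => hy.2) hDl hμ1
      (DerivBound.norm_le hG) hbs hbS hB₀0 (DerivBound.norm_le hbB)
    simp only [mul_zero, pow_zero, one_mul] at this
    exact this.trans (mul_le_mul_of_nonneg_left hvol hB₀0)
  have e1 : ‖∫ y, b y * Complex.exp (Complex.I * Φ y)‖ ≤
      2 ^ (k * k) * (D / lam * μ) ^ k * B₀ * volume.real K :=
    (norm_integral_mul_exp_le k hSc hUo hSU hΦU him (fun y hy => hy.2) hDl hμ1
      hG hbs hbS hB₀0 hbB).trans (mul_le_mul_of_nonneg_left hvol (by positivity))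
  -- For `lam ≥ 1` the estimate with `k` integrations by parts is used. For `lam ≤ 1`, where
  -- dividing by `lam` is harmful, the trivial estimate `e0` suffices; it accounts for the `+ 1` in
  -- the constant.
  have e2 : ‖∫ y, b y * Complex.exp (Complex.I * Φ y)‖ * (1 + lam) ^ k ≤
      2 ^ k * (2 ^ (k * k) * D ^ k + 1) * μ ^ k * (B₀ * volume.real K) := by
    have hX : 0 ≤ B₀ * volume.real K := by positivity
    rcases le_total 1 lam with h | h
    · have h1 : (1 + lam) ^ k ≤ 2 ^ k * lam ^ k := by
        rw [← mul_pow]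
        exact pow_le_pow_left₀ (by linarith) (by linarith) k
      calc _ ≤ 2 ^ (k * k) * (D / lam * μ) ^ k * B₀ * volume.real K * (2 ^ k * lam ^ k) :=
            mul_le_mul e1 h1 (by positivity) (by positivity)
        _ = 2 ^ k * (2 ^ (k * k) * D ^ k) * μ ^ k * (B₀ * volume.real K) := by
            rw [mul_pow, div_pow]; field_simp
        _ ≤ _ := by gcongr; linarith
    · have h1 : (1 + lam) ^ k ≤ 2 ^ k := pow_le_pow_left₀ (by linarith) (by linarith) k
      calc _ ≤ B₀ * volume.real K * 2 ^ k := mul_le_mul e0 h1 (by positivity) hX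
        _ = 2 ^ k * 1 * 1 * (B₀ * volume.real K) := by ring
        _ ≤ _ := by
            gcongr
            · have : 0 ≤ 2 ^ (k * k) * D ^ k := by positivity
              linarith
            · exact one_le_pow₀ hμ1
  have e3 := one_add_pow_mul_rpow_le (m := m) (δ := δ) (r := r) hMk hk hT0.le hL0 hlam
  rw [hJ]
  have hlk : 0 < (1 + lam) ^ k := by positivity
  refine le_of_mul_le_mul_right ?_ hlk
  calc (1 + L) ^ M * ‖∫ y, b y * Complex.exp (Complex.I * Φ y)‖ * (1 + lam) ^ k
      = (1 + L) ^ M * (‖∫ y, b y * Complex.exp (Complex.I * Φ y)‖ * (1 + lam) ^ k) := by ring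
    _ ≤ (1 + L) ^ M *
        (2 ^ k * (2 ^ (k * k) * D ^ k + 1) * μ ^ k * (B₀ * volume.real K)) := by gcongr
    _ = B * P * ((1 + L) ^ M * ((1 + T) ^ m * μ ^ k)) := by rw [hB, hB₀]; ring
    _ ≤ B * P * ((1 + lam) ^ k * (1 + T) ^ (-r)) := by gcongr
    _ = B * P * (1 + T) ^ (-r) * (1 + lam) ^ k := by ring

end FiberIntegral

/-! ### Removing the cutoff and constructing oscillatory integrals -/

section Limit

variable {E F : Type*} [NormedAddCommGroup E] [NormedSpace ℝ E]
  [NormedAddCommGroup F] [NormedSpace ℝ F]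
  [FiniteDimensional ℝ E] [MeasureSpace E] [BorelSpace E]
  [(volume : Measure E).IsAddHaarMeasure]
  [FiniteDimensional ℝ F] [Nontrivial F] [MeasureSpace F] [BorelSpace F]
  [(volume : Measure F).IsAddHaarMeasure]

theorem ae_ne_zero : ∀ᵐ θ : F, θ ≠ 0 := by
  simp [ae_iff]

/-- The integrand is controlled only off `θ = 0`, which is a null set because `F` is nontrivial. -/
theorem aestronglyMeasurable_of_continuousOn_snd_ne_zero {f : E × F → ℂ}
    (hf : ContinuousOn f {p | p.2 ≠ 0}) :
    AEStronglyMeasurable f ((volume : Measure E).prod (volume : Measure F)) := by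
  have h : ∀ᵐ p ∂((volume : Measure E).prod (volume : Measure F)), p ∈ {p : E × F | p.2 ≠ 0} :=
    Measure.quasiMeasurePreserving_snd.ae ae_ne_zero
  rw [← Measure.restrict_eq_self_of_ae_mem h]
  exact hf.aestronglyMeasurable isOpen_snd_ne_zero.measurableSet

variable {Γ : Set (E × F)} {φ a : E × F → ℂ}

theorem continuousOn_integrand_mul (hφ : IsPhaseFunction Γ φ) (hcs : coneSupport a ⊆ Γ)
    (ha : ContDiff ℝ ∞ a) {ψ : E → ℂ} (hψ : Continuous ψ) :
    ContinuousOn (fun p : E × F => integrand φ a p * ψ p.1) {p | p.2 ≠ 0} :=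
  (contDiffOn_integrand hφ hcs ha).continuousOn.mul (hψ.comp continuous_fst).continuousOn

theorem integrable_integrand_mul (hφ : IsPhaseFunction Γ φ) (hcs : coneSupport a ⊆ Γ)
    (ha : ContDiff ℝ ∞ a) {ψ : E → ℂ} (hψ : Continuous ψ) (hψc : HasCompactSupport ψ) {θ : F}
    (hθ : θ ≠ 0) : Integrable fun y => integrand φ a (y, θ) * ψ y := by
  have hc : Continuous fun y => integrand φ a (y, θ) * ψ y :=
    (continuousOn_integrand_mul hφ hcs ha hψ).comp_continuous (by fun_prop) fun _ => hθ
  exact hc.integrable_of_hasCompactSupport hψc.mul_left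

theorem aestronglyMeasurable_fiberIntegral (hφ : IsPhaseFunction Γ φ) (hcs : coneSupport a ⊆ Γ)
    (ha : ContDiff ℝ ∞ a) {ψ : E → ℂ} (hψ : Continuous ψ) :
    AEStronglyMeasurable (fiberIntegral φ a ψ) (volume : Measure F) :=
  (aestronglyMeasurable_of_continuousOn_snd_ne_zero
    (continuousOn_integrand_mul hφ hcs ha hψ)).prod_swap.integral_prod_right'

/-- Fubini's theorem for the regularized oscillatory integral. -/
theorem integral_integral_cutoff (hφ : IsPhaseFunction Γ φ) (hcs : coneSupport a ⊆ Γ)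
    (ha : ContDiff ℝ ∞ a) {ψ : E → ℂ} (hψ : Continuous ψ) (hψc : HasCompactSupport ψ)
    {g : F → ℂ} (hg : Continuous g) (hgc : HasCompactSupport g) :
    ∫ y : E, (∫ θ : F, g θ * a (y, θ) * Complex.exp (Complex.I * φ (y, θ))) * ψ y =
      ∫ θ : F, g θ * fiberIntegral φ a ψ θ := by
  have hint : Integrable (Function.uncurry fun (y : E) (θ : F) =>
      g θ * (integrand φ a (y, θ) * ψ y))
      ((volume : Measure E).prod (volume : Measure F)) := by
    have hdom : Integrable (fun p : E × F => ‖g p.2 * a p * ψ p.1‖)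
        ((volume : Measure E).prod (volume : Measure F)) := by
      have hc : Continuous fun p : E × F => g p.2 * a p * ψ p.1 := by
        have := ha.continuous
        fun_prop
      refine (hc.integrable_of_hasCompactSupport ?_).norm
      refine HasCompactSupport.intro (hψc.isCompact.prod hgc.isCompact) fun p hp => ?_
      rw [Set.mem_prod, not_and_or] at hp
      rcases hp with hp | hp <;> simp [image_eq_zero_of_notMem_tsupport hp]
    refine hdom.mono' ?_ ?_
    · exact aestronglyMeasurable_of_continuousOn_snd_ne_zero
        ((hg.comp continuous_snd).continuousOn.mul (continuousOn_integrand_mul hφ hcs ha hψ))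
    · filter_upwards [Measure.quasiMeasurePreserving_snd.ae (ae_ne_zero (F := F))] with p hp
      simp only [Function.uncurry, norm_mul]
      rw [← mul_assoc]
      gcongr
      exact norm_integrand_le hφ hcs hp
  calc ∫ y : E, (∫ θ : F, g θ * a (y, θ) * Complex.exp (Complex.I * φ (y, θ))) * ψ y
      = ∫ y : E, ∫ θ : F, g θ * (integrand φ a (y, θ) * ψ y) := by
        refine integral_congr_ae (ae_of_all _ fun y => ?_)
        simp only [← integral_mul_const, integrand]
        refine integral_congr_ae (ae_of_all _ fun θ => ?_)
        simp only
        ring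
    _ = ∫ θ : F, ∫ y : E, g θ * (integrand φ a (y, θ) * ψ y) := integral_integral_swap hint
    _ = _ := by simp only [fiberIntegral, integral_const_mul]

/-- The `L¹` size of `χ(ε·) - 1` with respect to the weight `(1 + |θ|) ^ (-r)`. -/
def cutoffError (χ : 𝓓((⊤ : Opens F), ℝ)) (r ε : ℝ) : ℝ :=
  ∫ θ : F, ‖(χ (ε • θ) : ℂ) - 1‖ * (1 + ‖θ‖) ^ (-r)

theorem exists_norm_cutoff_le (χ : 𝓓((⊤ : Opens F), ℝ)) :
    ∃ C : ℝ, 0 ≤ C ∧ ∀ θ, ‖(χ θ : ℂ)‖ ≤ C := by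
  obtain ⟨C, hC⟩ := χ.hasCompactSupport.exists_bound_of_continuous χ.continuous
  exact ⟨C, (norm_nonneg _).trans (hC 0), fun θ => by simpa using hC θ⟩

theorem integrable_cutoffError (χ : 𝓓((⊤ : Opens F), ℝ)) {r : ℝ}
    (hr : (Module.finrank ℝ F : ℝ) < r) (ε : ℝ) :
    Integrable fun θ : F => ‖(χ (ε • θ) : ℂ) - 1‖ * (1 + ‖θ‖) ^ (-r) := by
  obtain ⟨C, hC, h⟩ := exists_norm_cutoff_le χ
  have hχ := χ.continuous
  refine (integrable_one_add_norm hr).bdd_mul (c := C + 1) (by fun_prop) (ae_of_all _ fun θ => ?_)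
  rw [norm_norm]
  exact (norm_sub_le _ _).trans (by simpa using h (ε • θ))

/-- Dominated convergence: `χ` is bounded, and the weight is integrable because `r` exceeds the
dimension. Isolating this error lets the convergence be uniform in the covector later. -/
theorem tendsto_cutoffError (χ : 𝓓((⊤ : Opens F), ℝ)) (hχ : χ 0 = 1) {r : ℝ}
    (hr : (Module.finrank ℝ F : ℝ) < r) :
    Tendsto (cutoffError χ r) (𝓝[>] 0) (𝓝 0) := by
  obtain ⟨C, hC, h⟩ := exists_norm_cutoff_le χ
  have hχc := χ.continuous
  suffices h' : Tendsto (cutoffError χ r) (𝓝[>] 0) (𝓝 (∫ _ : F, (0 : ℝ))) by simpa using h'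
  refine tendsto_integral_filter_of_dominated_convergence
    (fun θ => (C + 1) * (1 + ‖θ‖) ^ (-r)) ?_ ?_ ((integrable_one_add_norm hr).const_mul _) ?_
  · exact Eventually.of_forall fun ε => (integrable_cutoffError χ hr ε).aestronglyMeasurable
  · refine Eventually.of_forall fun ε => ae_of_all _ fun θ => ?_
    rw [norm_mul, norm_norm, Real.norm_of_nonneg (by positivity : 0 ≤ (1 + ‖θ‖) ^ (-r))]
    gcongr
    exact (norm_sub_le _ _).trans (by simpa using h (ε • θ))
  · refine ae_of_all _ fun θ => ?_
    have hc : Continuous fun ε : ℝ => ‖(χ (ε • θ) : ℂ) - 1‖ * (1 + ‖θ‖) ^ (-r) := by fun_prop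
    have := hc.tendsto 0
    simp only [zero_smul, hχ, Complex.ofReal_one, sub_self, norm_zero, zero_mul] at this
    exact this.mono_left nhdsWithin_le_nhds

theorem integrable_of_norm_le_rpow {J : F → ℂ} (hJ : AEStronglyMeasurable J volume) {B r : ℝ}
    (hr : (Module.finrank ℝ F : ℝ) < r) (h : ∀ θ, θ ≠ 0 → ‖J θ‖ ≤ B * (1 + ‖θ‖) ^ (-r)) :
    Integrable J :=
  ((integrable_one_add_norm hr).const_mul B).mono' hJ (ae_ne_zero.mono h)

theorem norm_integral_cutoff_sub_le {J : F → ℂ} (hJ : AEStronglyMeasurable J volume) {B r : ℝ}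
    (hr : (Module.finrank ℝ F : ℝ) < r) (h : ∀ θ, θ ≠ 0 → ‖J θ‖ ≤ B * (1 + ‖θ‖) ^ (-r))
    (χ : 𝓓((⊤ : Opens F), ℝ)) (ε : ℝ) :
    ‖(∫ θ : F, (χ (ε • θ) : ℂ) * J θ) - ∫ θ, J θ‖ ≤ B * cutoffError χ r ε := by
  obtain ⟨C, hC, hχb⟩ := exists_norm_cutoff_le χ
  have hχ := χ.continuous
  have hJi := integrable_of_norm_le_rpow hJ hr h
  have hχJ : Integrable fun θ : F => (χ (ε • θ) : ℂ) * J θ :=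
    hJi.bdd_mul (c := C) (by fun_prop) (ae_of_all _ fun θ => hχb _)
  rw [← integral_sub hχJ hJi, cutoffError, ← integral_const_mul]
  refine norm_integral_le_of_norm_le ((integrable_cutoffError χ hr ε).const_mul B) ?_
  filter_upwards [ae_ne_zero] with θ hθ
  have e : (χ (ε • θ) : ℂ) * J θ - J θ = ((χ (ε • θ) : ℂ) - 1) * J θ := by ring
  rw [e, norm_mul]
  calc _ ≤ ‖(χ (ε • θ) : ℂ) - 1‖ * (B * (1 + ‖θ‖) ^ (-r)) := by
        gcongr; exact h θ hθ
    _ = _ := by ring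

theorem hasCompactSupport_cutoff (χ : 𝓓((⊤ : Opens F), ℝ)) {ε : ℝ} (hε : ε ≠ 0) :
    HasCompactSupport fun θ : F => (χ (ε • θ) : ℂ) :=
  (χ.hasCompactSupport.comp_smul hε).comp_left Complex.ofReal_zero

theorem continuous_cutoff (χ : 𝓓((⊤ : Opens F), ℝ)) (ε : ℝ) :
    Continuous fun θ : F => (χ (ε • θ) : ℂ) := by
  have := χ.continuous
  fun_prop

/-- The regularized oscillatory integrals, tested against `ψ`, differ from the integral of
`fiberIntegral φ a ψ` by a multiple of the cutoff error. -/
theorem norm_regularized_sub_le (hφ : IsPhaseFunction Γ φ) (hcs : coneSupport a ⊆ Γ)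
    (ha : ContDiff ℝ ∞ a) {ψ : E → ℂ} (hψ : Continuous ψ) (hψc : HasCompactSupport ψ) {B r : ℝ}
    (hr : (Module.finrank ℝ F : ℝ) < r)
    (h : ∀ θ, θ ≠ 0 → ‖fiberIntegral φ a ψ θ‖ ≤ B * (1 + ‖θ‖) ^ (-r))
    (χ : 𝓓((⊤ : Opens F), ℝ)) {ε : ℝ} (hε : ε ≠ 0) :
    ‖(∫ y : E, (∫ θ : F, (χ (ε • θ) : ℂ) * a (y, θ) * Complex.exp (Complex.I * φ (y, θ))) * ψ y)
      - ∫ θ, fiberIntegral φ a ψ θ‖ ≤ B * cutoffError χ r ε := by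
  rw [integral_integral_cutoff hφ hcs ha hψ hψc (continuous_cutoff χ ε)
    (hasCompactSupport_cutoff χ hε)]
  exact norm_integral_cutoff_sub_le (aestronglyMeasurable_fiberIntegral hφ hcs ha hψ) hr h χ ε

theorem tendsto_regularized (hφ : IsPhaseFunction Γ φ) (hcs : coneSupport a ⊆ Γ)
    (ha : ContDiff ℝ ∞ a) {ψ : E → ℂ} (hψ : Continuous ψ) (hψc : HasCompactSupport ψ) {B r : ℝ}
    (hr : (Module.finrank ℝ F : ℝ) < r)
    (h : ∀ θ, θ ≠ 0 → ‖fiberIntegral φ a ψ θ‖ ≤ B * (1 + ‖θ‖) ^ (-r))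
    (χ : 𝓓((⊤ : Opens F), ℝ)) (hχ : χ 0 = 1) :
    Tendsto (fun ε : ℝ =>
      ∫ y : E, (∫ θ : F, (χ (ε • θ) : ℂ) * a (y, θ) * Complex.exp (Complex.I * φ (y, θ))) * ψ y)
      (𝓝[>] 0) (𝓝 (∫ θ, fiberIntegral φ a ψ θ)) := by
  rw [tendsto_iff_norm_sub_tendsto_zero]
  have h1 : Tendsto (fun ε => B * cutoffError χ r ε) (𝓝[>] 0) (𝓝 0) := by
    simpa using (tendsto_cutoffError χ hχ hr).const_mul B
  refine squeeze_zero' (Eventually.of_forall fun _ => norm_nonneg _) ?_ h1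
  filter_upwards [self_mem_nhdsWithin] with ε hε
  exact norm_regularized_sub_le hφ hcs ha hψ hψc hr h χ (ne_of_gt hε)

/-- If `φ` is nowhere stationary in the direction `w` on the conic support of `a`, the oscillatory
integral exists, and it is the iterated integral taken first in `y` and then in `θ`. -/
theorem exists_isOscillatoryIntegral {m ρ δ : ℝ} (hφ : IsPhaseFunction Γ φ)
    (hcs : coneSupport a ⊆ Γ) (ha : IsSymbol m ρ δ a) (hδ₀ : 0 ≤ δ) (hδ₁ : δ < 1) (w : E)
    (hw : ∀ p ∈ coneSupport a, fderiv ℝ φ p (w, 0) ≠ 0) :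
    ∃ u : 𝓓'((⊤ : Opens E), ℂ), IsOscillatoryIntegral m ρ δ φ a u ∧
      ∀ ψ : 𝓓((⊤ : Opens E), ℝ), u ψ = ∫ θ : F, fiberIntegral φ a (fun y => (ψ y : ℂ)) θ := by
  obtain ⟨r, hr⟩ := exists_gt (Module.finrank ℝ F : ℝ)
  -- The decay is linear in finitely many seminorms of `ψ`, with constants depending only on `K`.
  -- This gives both the integrability in `θ` and the continuity of the functional.
  have key : ∀ K : Set E, IsCompact K → ∃ (k : ℕ) (B : ℝ), 0 ≤ B ∧
      ∀ ψ : E → ℝ, ContDiff ℝ ∞ ψ → tsupport ψ ⊆ K → ∀ P : ℝ, 0 ≤ P →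
        (∀ j ≤ k, ∀ y ∈ K, ‖iteratedFDeriv ℝ j ψ y‖ ≤ P) → ∀ θ : F, θ ≠ 0 →
          ‖fiberIntegral φ a (fun y => (ψ y : ℂ)) θ‖ ≤ B * P * (1 + ‖θ‖) ^ (-r) := by
    intro K hK
    obtain ⟨c, hc, hlow⟩ := (hφ.isHomogeneousOn.fderiv_apply hφ.isOpen hφ.isConic w).exists_le_norm
      hcs hK fun y _ θ hp => hw _ hp
    obtain ⟨k, B, hB, h⟩ := exists_fiberIntegral_le hφ hcs ha hδ₀ hδ₁ w hK hc 0 r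
    refine ⟨k, B, hB, fun ψ hψ hψK P hP0 hP θ hθ => ?_⟩
    simpa using h θ 0 hθ (fun y hy hp => by simpa using hlow y hy θ hp) ψ hψ hψK P hP0 hP
  have hcont : ∀ ψ : E → ℝ, ContDiff ℝ ∞ ψ → Continuous fun y => (ψ y : ℂ) := fun ψ hψ =>
    Complex.continuous_ofReal.comp hψ.continuous
  have hsupp : ∀ ψ : E → ℝ, HasCompactSupport ψ → HasCompactSupport fun y => (ψ y : ℂ) :=
    fun ψ hψ => hψ.comp_left Complex.ofReal_zero
  have hbound : ∀ ψ : E → ℝ, ContDiff ℝ ∞ ψ → HasCompactSupport ψ → ∃ B : ℝ,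
      ∀ θ : F, θ ≠ 0 → ‖fiberIntegral φ a (fun y => (ψ y : ℂ)) θ‖ ≤ B * (1 + ‖θ‖) ^ (-r) := by
    intro ψ hψ hψc
    obtain ⟨k, B, hB, h⟩ := key _ hψc.isCompact
    choose P hP using fun j : ℕ => (hψc.iteratedFDeriv (𝕜 := ℝ) j).exists_bound_of_continuous
      (hψ.continuous_iteratedFDeriv (m := j) (by exact_mod_cast le_top))
    have hP0 : ∀ j, 0 ≤ P j := fun j => (norm_nonneg _).trans (hP j 0)
    exact ⟨B * ∑ j ∈ Finset.range (k + 1), P j, fun θ hθ => h ψ hψ subset_rfl _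
      (Finset.sum_nonneg fun j _ => hP0 j) (fun j hj y _ => (hP j y).trans
        (Finset.single_le_sum (fun j _ => hP0 j) (Finset.mem_range.2 (by omega)))) θ hθ⟩
  have hint : ∀ ψ : E → ℝ, ContDiff ℝ ∞ ψ → HasCompactSupport ψ →
      Integrable (fiberIntegral φ a fun y => (ψ y : ℂ)) := fun ψ hψ hψc => by
    obtain ⟨B, hB⟩ := hbound ψ hψ hψc
    exact integrable_of_norm_le_rpow
      (aestronglyMeasurable_fiberIntegral hφ hcs ha.1 (hcont ψ hψ)) hr hB
  have hadd : ∀ f g : E → ℝ, ContDiff ℝ ∞ f → HasCompactSupport f → ContDiff ℝ ∞ g →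
      HasCompactSupport g → ∫ θ : F, fiberIntegral φ a (fun y => ((f y + g y : ℝ) : ℂ)) θ =
        (∫ θ : F, fiberIntegral φ a (fun y => (f y : ℂ)) θ) +
          ∫ θ : F, fiberIntegral φ a (fun y => (g y : ℂ)) θ := by
    intro f g hf hfc hg hgc
    rw [← integral_add (hint f hf hfc) (hint g hg hgc)]
    refine integral_congr_ae ?_
    filter_upwards [ae_ne_zero] with θ hθ
    simp only [fiberIntegral]
    rw [← integral_add (integrable_integrand_mul hφ hcs ha.1 (hcont f hf) (hsupp f hfc) hθ)
      (integrable_integrand_mul hφ hcs ha.1 (hcont g hg) (hsupp g hgc) hθ)]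
    refine integral_congr_ae (ae_of_all _ fun y => ?_)
    simp only [Complex.ofReal_add, mul_add]
  have hsmul : ∀ (c : ℝ) (f : E → ℝ),
      ∫ θ : F, fiberIntegral φ a (fun y => ((c * f y : ℝ) : ℂ)) θ =
        c • ∫ θ : F, fiberIntegral φ a (fun y => (f y : ℂ)) θ := by
    intro c f
    rw [← integral_smul]
    refine integral_congr_ae (ae_of_all _ fun θ => ?_)
    simp only [fiberIntegral]
    rw [← integral_smul]
    refine integral_congr_ae (ae_of_all _ fun y => ?_)
    simp only [Complex.ofReal_mul, Complex.real_smul]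
    ring
  -- Continuity is checked on test functions supported in a fixed compact set, where it is the bound
  -- from `key` integrated over `θ`.
  let u : 𝓓'((⊤ : Opens E), ℂ) := TestFunction.limitCLM ℝ
    (fun ψ : 𝓓((⊤ : Opens E), ℝ) => ∫ θ : F, fiberIntegral φ a (fun y => (ψ y : ℂ)) θ)
    (fun K _ => ContDiffMapSupportedIn.mkCLMtoNormedSpace ℝ
      (fun ψ => ∫ θ : F, fiberIntegral φ a (fun y => (ψ y : ℂ)) θ)
      (fun f g => hadd f g f.contDiff f.hasCompactSupport g.contDiff g.hasCompactSupport)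
      (fun c f => hsmul c f)
      (by
        obtain ⟨k, B, hB, h⟩ := key K K.isCompact
        refine ⟨Finset.range (k + 1), B * ∫ θ : F, (1 + ‖θ‖) ^ (-r), ?_, fun f => ?_⟩
        · exact mul_nonneg hB (integral_nonneg fun θ => by positivity)
        · set P : ℝ := ((Finset.range (k + 1)).sup fun i =>
            ContDiffMapSupportedIn.seminorm ℝ E ℝ ⊤ K i) f
          have hP0 : 0 ≤ P := apply_nonneg _ _
          have h1 := h f f.contDiff f.tsupport_subset P hP0 fun j hj y _ =>
            (ContDiffMapSupportedIn.norm_iteratedFDeriv_apply_le_seminorm_top ℝ).trans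
              (Seminorm.le_finset_sup_apply (Finset.mem_range.2 (by omega)))
          calc _ ≤ ∫ θ : F, B * P * (1 + ‖θ‖) ^ (-r) :=
                norm_integral_le_of_norm_le ((integrable_one_add_norm hr).const_mul _)
                  (ae_ne_zero.mono h1)
            _ = _ := by rw [integral_const_mul]; ring))
    (fun _ _ _ => rfl)
  refine ⟨u, ⟨⟨Γ, hφ, hcs⟩, ha, fun χ hχ ψ => ?_⟩, fun ψ => rfl⟩
  obtain ⟨B, hB⟩ := hbound ψ ψ.contDiff ψ.hasCompactSupport
  exact tendsto_regularized hφ hcs ha.1 (hcont ψ ψ.contDiff) (hsupp ψ ψ.hasCompactSupport) hr hB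
    χ hχ

end Limit

/-! ### Smoothness of the regularized integrals -/

section SmoothRegularization

variable {E F : Type*} [NormedAddCommGroup E] [NormedSpace ℝ E]
  [NormedAddCommGroup F] [NormedSpace ℝ F]

/-- `B` is smooth off `θ = 0` and bounded on bounded sets of `θ`, locally uniformly in `y`. -/
def IsLocallyBoundedSmooth (B : E × F → ℂ) : Prop :=
  ContDiffOn ℝ ∞ B {p | p.2 ≠ 0} ∧ ∀ K : Set E, IsCompact K → ∀ R : ℝ, ∃ C : ℝ,
    ∀ y ∈ K, ∀ θ : F, θ ≠ 0 → ‖θ‖ ≤ R → ‖B (y, θ)‖ ≤ C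

/-- `B` is smooth off `θ = 0`, and its derivatives of order at most `k` in `y` are bounded on
bounded sets of `θ`, locally uniformly in `y`. -/
def HasBoundedDerivs : ℕ → (E × F → ℂ) → Prop
  | 0, B => IsLocallyBoundedSmooth B
  | k + 1, B => IsLocallyBoundedSmooth B ∧
      ∀ w : E, HasBoundedDerivs k (fun p => fderiv ℝ B p (w, 0))

theorem HasBoundedDerivs.zero {k : ℕ} {B : E × F → ℂ} (h : HasBoundedDerivs k B) :
    IsLocallyBoundedSmooth B := by
  cases k with
  | zero => exact h
  | succ k => exact h.1

theorem HasBoundedDerivs.congr {k : ℕ} {B B' : E × F → ℂ} (h : HasBoundedDerivs k B)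
    (hB : Set.EqOn B B' {p | p.2 ≠ 0}) : HasBoundedDerivs k B' := by
  have h0 : ∀ {B B' : E × F → ℂ}, IsLocallyBoundedSmooth B → Set.EqOn B B' {p | p.2 ≠ 0} →
      IsLocallyBoundedSmooth B' := fun h hB => ⟨h.1.congr fun p hp => (hB hp).symm, fun K hK R => by
    obtain ⟨C, hC⟩ := h.2 K hK R
    exact ⟨C, fun y hy θ hθ hR => by rw [← hB (show (y, θ) ∈ _ from hθ)]; exact hC y hy θ hθ hR⟩⟩
  induction k generalizing B B' with
  | zero => exact h0 h hB
  | succ k ih =>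
    refine ⟨h0 h.1 hB, fun w => ih (h.2 w) fun p hp => ?_⟩
    have : B =ᶠ[𝓝 p] B' := hB.eventuallyEq_of_mem (isOpen_snd_ne_zero.mem_nhds hp)
    simp only [this.fderiv_eq]

theorem HasBoundedDerivs.add {k : ℕ} {B B' : E × F → ℂ} (h : HasBoundedDerivs k B)
    (h' : HasBoundedDerivs k B') : HasBoundedDerivs k (fun p => B p + B' p) := by
  have h0 : ∀ {B B' : E × F → ℂ}, IsLocallyBoundedSmooth B → IsLocallyBoundedSmooth B' →
      IsLocallyBoundedSmooth (fun p => B p + B' p) := fun h h' => ⟨h.1.add h'.1, fun K hK R => by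
    obtain ⟨C, hC⟩ := h.2 K hK R
    obtain ⟨C', hC'⟩ := h'.2 K hK R
    exact ⟨C + C', fun y hy θ hθ hR =>
      (norm_add_le _ _).trans (add_le_add (hC y hy θ hθ hR) (hC' y hy θ hθ hR))⟩⟩
  induction k generalizing B B' with
  | zero => exact h0 h h'
  | succ k ih =>
    refine ⟨h0 h.1 h'.1, fun w => (ih (h.2 w) (h'.2 w)).congr fun p hp => ?_⟩
    simp only [fderiv_fun_add (differentiableAt_of_contDiffOn isOpen_snd_ne_zero h.1.1 hp)
      (differentiableAt_of_contDiffOn isOpen_snd_ne_zero h'.1.1 hp), add_apply]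

/-- The class of products `b s e^{iφ}` is stable under base derivatives up to sums: the derivative
falls on `b`, on `s` (same degree), or on the exponential, which raises the degree of `s` by one.
Each product is bounded for bounded `θ` since `|e^{iφ}| ≤ 1` on the cone and `s` is `O(‖θ‖ ^ d)`. -/
theorem hasBoundedDerivs_mul_exp [FiniteDimensional ℝ F] {Γ : Set (E × F)} {φ a : E × F → ℂ}
    (hφ : IsPhaseFunction Γ φ) (hcs : coneSupport a ⊆ Γ) (k : ℕ) {d : ℕ} {b s : E × F → ℂ}
    (hb : ContDiff ℝ ∞ b) (hba : tsupport b ⊆ tsupport a) (hs : IsHomogeneousOn Γ d s) :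
    HasBoundedDerivs k fun p => b p * (s p * Complex.exp (Complex.I * φ p)) := by
  have h0 : ∀ {d : ℕ} {b s : E × F → ℂ}, ContDiff ℝ ∞ b → tsupport b ⊆ tsupport a →
      IsHomogeneousOn Γ d s →
      IsLocallyBoundedSmooth fun p => b p * (s p * Complex.exp (Complex.I * φ p)) := by
    intro d b s hb hba hs
    refine ⟨contDiffOn_mul_of_coneSupport_subset hφ.isOpen hcs hb hba
      (hs.contDiffOn.mul (contDiffOn_cexp hφ.contDiffOn)), fun K hK R => ?_⟩
    obtain ⟨C, hC, hCs⟩ := hs.exists_norm_le hcs hK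
    obtain ⟨D, hD⟩ := (hK.prod (isCompact_closedBall (0 : F) R)).exists_bound_of_continuousOn
      hb.continuous.continuousOn
    refine ⟨max D 0 * (C * max R 0 ^ d), fun y hy θ hθ hR => ?_⟩
    by_cases hp : (y, θ) ∈ tsupport b
    · have hpc := mem_coneSupport_of_mem_tsupport (hba hp) hθ
      rw [norm_mul, norm_mul]
      have h1 : ‖b (y, θ)‖ ≤ max D 0 := (hD _ ⟨hy, by simpa using hR⟩).trans (le_max_left _ _)
      have h2 : ‖s (y, θ)‖ ≤ C * max R 0 ^ d := (hCs y hy θ hpc).trans (by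
        gcongr; exact hR.trans (le_max_left _ _))
      refine mul_le_mul h1 ?_ (by positivity) (le_max_right _ _)
      exact (mul_le_of_le_one_right (norm_nonneg _)
        (norm_cexp_I_mul_le_one (hφ.im_nonneg _ (hcs hpc)))).trans h2
    · simp only [image_eq_zero_of_notMem_tsupport hp, zero_mul, norm_zero]
      positivity
  induction k generalizing d b s with
  | zero => exact h0 hb hba hs
  | succ k ih =>
    refine ⟨h0 hb hba hs, fun w => ?_⟩
    have hDb : ContDiff ℝ ∞ fun p => fderiv ℝ b p (w, 0) :=
      (hb.fderiv_right (m := ∞) (by simp)).clm_apply contDiff_const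
    have hDφ := hφ.isHomogeneousOn.fderiv_apply hφ.isOpen hφ.isConic w
    refine (((ih hDb ((tsupport_fderiv_apply_subset ℝ _).trans hba) hs).add
      (ih hb hba (hs.fderiv_apply hφ.isOpen hφ.isConic w))).add
      (ih hb hba ((hs.mul hDφ).const_mul Complex.I))).congr fun p hp => ?_
    by_cases hpa : p ∈ tsupport b
    · have hpΓ := mem_of_mem_tsupport hcs (hba hpa) hp
      have hsd := differentiableAt_of_contDiffOn hφ.isOpen hs.contDiffOn hpΓ
      have hφd := differentiableAt_of_contDiffOn hφ.isOpen hφ.contDiffOn hpΓ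
      have hed : HasFDerivAt (fun p => Complex.exp (Complex.I * φ p)) _ p :=
        (hφd.hasFDerivAt.const_mul Complex.I).cexp
      simp only
      rw [fderiv_mul_apply (hb.differentiable (by simp) p) (hsd.fun_mul hed.differentiableAt),
        fderiv_mul_apply hsd hed.differentiableAt, hed.fderiv]
      simp only [smul_apply, smul_eq_mul]
      ring
    · have h1 := notMem_tsupport_iff_eventuallyEq.1 hpa
      have h2 : (fun p => b p * (s p * Complex.exp (Complex.I * φ p))) =ᶠ[𝓝 p] fun _ => 0 := by
        filter_upwards [h1] with z hz
        simp [hz]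
      simp only [h2.fderiv_eq, h1.fderiv_eq, h1.eq_of_nhds]
      simp

theorem continuousOn_slice_right {G : Type*} [TopologicalSpace G] {f : E × F → G} (y : E)
    (hf : ContinuousOn f {p | p.2 ≠ 0}) : ContinuousOn (fun θ => f (y, θ)) {θ | θ ≠ 0} :=
  hf.comp (by fun_prop) fun _ hθ => hθ

variable [FiniteDimensional ℝ E]
  [FiniteDimensional ℝ F] [Nontrivial F] [MeasureSpace F] [BorelSpace F]
  [(volume : Measure F).IsAddHaarMeasure]

theorem aestronglyMeasurable_of_continuousOn_ne_zero {G : Type*} [NormedAddCommGroup G]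
    {f : F → G} (hf : ContinuousOn f {θ | θ ≠ 0}) : AEStronglyMeasurable f volume := by
  rw [← Measure.restrict_eq_self_of_ae_mem (s := {θ : F | θ ≠ 0}) ae_ne_zero]
  exact hf.aestronglyMeasurable isOpen_ne.measurableSet

/-- Differentiation under the integral sign, dominated by the local bounds on the support of `g`.
The extra derivative in the hypothesis lets the base case obtain continuity from differentiability.
-/
theorem HasBoundedDerivs.contDiff_integral {k : ℕ} {B : E × F → ℂ}
    (h : HasBoundedDerivs (k + 1) B) {g : F → ℂ} (hg : Continuous g) (hgc : HasCompactSupport g) :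
    ContDiff ℝ k fun y => ∫ θ, g θ * B (y, θ) := by
  obtain ⟨R, hR⟩ := hgc.isCompact.isBounded.subset_closedBall (0 : F)
  have hgi : Integrable g := hg.integrable_of_hasCompactSupport hgc
  have hderiv : ∀ {B : E × F → ℂ}, HasBoundedDerivs 1 B → ∀ y, HasFDerivAt
      (fun y => ∫ θ, g θ * B (y, θ))
      (∫ θ, g θ • (fderiv ℝ B (y, θ)).comp (.inl ℝ E F)) y ∧
      Integrable fun θ => g θ • (fderiv ℝ B (y, θ)).comp (.inl ℝ E F) := by
    intro B h y
    have hK := isCompact_closedBall y 1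
    have hmeas : ∀ y, AEStronglyMeasurable (fun θ => g θ * B (y, θ)) volume := fun y =>
      aestronglyMeasurable_of_continuousOn_ne_zero
        (hg.continuousOn.mul (continuousOn_slice_right y h.1.1.continuousOn))
    have hDc : ContinuousOn (fun p => (fderiv ℝ B p).comp (.inl ℝ E F)) {p | p.2 ≠ 0} :=
      ((h.1.1.fderiv_of_isOpen isOpen_snd_ne_zero (m := ∞) (by simp)).continuousOn).clm_comp
        continuousOn_const
    have hmeas' : AEStronglyMeasurable
        (fun θ => g θ • (fderiv ℝ B (y, θ)).comp (.inl ℝ E F)) volume :=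
      aestronglyMeasurable_of_continuousOn_ne_zero (hg.continuousOn.smul (continuousOn_slice_right y hDc))
    obtain ⟨C, hC⟩ := h.1.2 _ hK R
    -- The hypotheses bound derivatives one direction at a time; finitely many basis directions
    -- control the operator norm.
    obtain ⟨c, hc, hcb⟩ := (Module.finBasis ℝ E).exists_opNorm_le (F := ℂ)
    choose D hD using fun i => (h.2 (Module.finBasis ℝ E i)).2 _ hK R
    set X : ℝ := ∑ i, |D i| with hX
    have hX0 : 0 ≤ X := Finset.sum_nonneg fun i _ => abs_nonneg _
    have hbd : ∀ θ, θ ≠ 0 → ∀ z ∈ Metric.closedBall y 1,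
        ‖g θ • (fderiv ℝ B (z, θ)).comp (.inl ℝ E F)‖ ≤ ‖g θ‖ * (c * X) := by
      intro θ hθ z hz
      rw [norm_smul]
      by_cases hgθ : θ ∈ tsupport g
      · gcongr
        refine hcb hX0 fun i => ?_
        have h1 := hD i z hz θ hθ (by simpa using hR hgθ)
        simp only [ContinuousLinearMap.comp_apply, ContinuousLinearMap.inl_apply]
        exact h1.trans ((le_abs_self _).trans
          (Finset.single_le_sum (f := fun i => |D i|) (fun i _ => abs_nonneg _)
            (Finset.mem_univ i)))
      · simp [image_eq_zero_of_notMem_tsupport hgθ]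
    have hbi : Integrable fun θ => ‖g θ‖ * (c * X) := hgi.norm.mul_const _
    refine ⟨?_, hbi.mono' hmeas' (ae_ne_zero.mono fun θ hθ =>
      hbd θ hθ y (Metric.mem_closedBall_self zero_le_one))⟩
    refine hasFDerivAt_integral_of_dominated_of_fderiv_le (𝕜 := ℝ)
      (F' := fun y θ => g θ • (fderiv ℝ B (y, θ)).comp (.inl ℝ E F))
      (bound := fun θ => ‖g θ‖ * (c * X)) (Metric.closedBall_mem_nhds y one_pos)
      (Eventually.of_forall hmeas) ?_ hmeas' (ae_ne_zero.mono hbd) hbi ?_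
    · refine (hgi.norm.mul_const C).mono' (hmeas y) (ae_ne_zero.mono fun θ hθ => ?_)
      rw [norm_mul]
      by_cases hgθ : θ ∈ tsupport g
      · gcongr
        exact hC y (Metric.mem_closedBall_self zero_le_one) θ hθ (by simpa using hR hgθ)
      · simp [image_eq_zero_of_notMem_tsupport hgθ]
    · exact ae_ne_zero.mono fun θ hθ z _ =>
        (hasFDerivAt_slice isOpen_snd_ne_zero h.1.1 (show (z, θ) ∈ _ from hθ)).const_mul (g θ)
  induction k generalizing B with
  | zero =>
    exact contDiff_zero.2 (continuous_iff_continuousAt.2 fun y => (hderiv h y).1.continuousAt)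
  | succ k ih =>
    have h1 : HasBoundedDerivs 1 B := ⟨h.1, fun w => (h.2 w).zero⟩
    rw [Nat.cast_succ, contDiff_succ_iff_fderiv_apply]
    refine ⟨fun y => (hderiv h1 y).1.differentiableAt, fun h => by simp at h, fun w => ?_⟩
    convert ih (h.2 w) using 2 with y
    rw [(hderiv h1 y).1.fderiv, ContinuousLinearMap.integral_apply (hderiv h1 y).2]
    simp

/-- The regularized oscillatory integrals are smooth functions. -/
theorem contDiff_regularized {Γ : Set (E × F)} {φ a : E × F → ℂ}
    (hφ : IsPhaseFunction Γ φ) (hcs : coneSupport a ⊆ Γ) (ha : ContDiff ℝ ∞ a) {g : F → ℂ}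
    (hg : Continuous g) (hgc : HasCompactSupport g) :
    ContDiff ℝ ∞ fun y => ∫ θ : F, g θ * a (y, θ) * Complex.exp (Complex.I * φ (y, θ)) := by
  have h1 : IsHomogeneousOn Γ 0 (fun _ => (1 : ℂ)) := ⟨contDiffOn_const, fun _ _ _ _ => by simp⟩
  rw [contDiff_infty]
  intro k
  have h2 := (hasBoundedDerivs_mul_exp hφ hcs (k + 1) ha subset_rfl h1).contDiff_integral hg hgc
  simpa only [one_mul, mul_assoc] using h2

end SmoothRegularization

/-! ### Restricting phases and symbols to the line -/

section Restriction

variable {X F : Type*} [NormedAddCommGroup X] [NormedSpace ℝ X]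
  [NormedAddCommGroup F] [NormedSpace ℝ F]

theorem hasFDerivAt_lineEmbedding (x : X) (p : ℝ × F) :
    HasFDerivAt (fun p : ℝ × F => ((x, p.1), p.2))
      ((ContinuousLinearMap.inr ℝ X ℝ).prodMap (ContinuousLinearMap.id ℝ F)) p := by
  have h := ((ContinuousLinearMap.inr ℝ X ℝ).prodMap
    (ContinuousLinearMap.id ℝ F)).hasFDerivAt (x := p)
  have h2 := h.const_add ((x, (0 : ℝ)), (0 : F))
  refine h2.congr_of_eventuallyEq (Eventually.of_forall fun q => ?_)
  ext <;> simp

theorem fderiv_restrict_apply {Γ : Set ((X × ℝ) × F)} {φ : (X × ℝ) × F → ℂ}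
    (hφ : IsPhaseFunction Γ φ) {x : X} {p : ℝ × F} (hp : ((x, p.1), p.2) ∈ Γ) :
    fderiv ℝ (fun p : ℝ × F => φ ((x, p.1), p.2)) p (1, 0) =
      fderiv ℝ φ ((x, p.1), p.2) ((0, 1), 0) := by
  have := ((differentiableAt_of_contDiffOn hφ.isOpen hφ.contDiffOn hp).hasFDerivAt).comp p
    (hasFDerivAt_lineEmbedding x p)
  have h2 := this.fderiv
  simp only [Function.comp_def] at h2
  rw [h2]
  simp

theorem deriv_restrict {Γ : Set ((X × ℝ) × F)} {φ : (X × ℝ) × F → ℂ}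
    (hφ : IsPhaseFunction Γ φ) {x : X} {t : ℝ} {θ : F} (hp : ((x, t), θ) ∈ Γ) :
    deriv (fun s => φ ((x, s), θ)) t = fderiv ℝ φ ((x, t), θ) ((0, 1), 0) := by
  have h1 := (hasFDerivAt_slice hφ.isOpen hφ.contDiffOn hp).comp_hasDerivAt t
    ((hasDerivAt_const t x).prodMk (hasDerivAt_id t))
  have h2 := h1.deriv
  simp only [Function.comp_def] at h2
  rw [h2]
  simp

theorem coneSupport_restrict_subset {a : (X × ℝ) × F → ℂ} {x : X} {p : ℝ × F}
    (hp : p ∈ coneSupport fun p : ℝ × F => a ((x, p.1), p.2)) :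
    ((x, p.1), p.2) ∈ coneSupport a := by
  have hj : Continuous fun p : ℝ × F => ((x, p.1), p.2) := by fun_prop
  refine ⟨map_mem_closure (f := fun p : ℝ × F => ((x, p.1), p.2)) hj hp.1 ?_, hp.2⟩
  rintro _ ⟨q, hq, hq0, r, hr, rfl⟩
  refine ⟨((x, q.1), q.2), ?_, hq0, r, hr, rfl⟩
  exact map_mem_closure (f := fun p : ℝ × F => ((x, p.1), p.2)) hj hq fun z hz => hz

/-- Restriction may create critical points, so the cone is cut down to where `∂_t φ ≠ 0`. That set
stays open, and it stays conic because `∂_t φ` is homogeneous. -/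
theorem IsPhaseFunction.restrict {Γ : Set ((X × ℝ) × F)} {φ : (X × ℝ) × F → ℂ}
    (hφ : IsPhaseFunction Γ φ) (x : X) :
    IsPhaseFunction {p : ℝ × F | ((x, p.1), p.2) ∈ Γ ∩ {p | fderiv ℝ φ p ((0, 1), 0) ≠ 0}}
      (fun p : ℝ × F => φ ((x, p.1), p.2)) where
  isOpen := by
    have h : IsOpen (Γ ∩ {p | fderiv ℝ φ p ((0, 1), 0) ≠ 0}) :=
      (contDiffOn_fderiv_apply hφ.isOpen hφ.contDiffOn _).continuousOn.isOpen_inter_preimage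
        hφ.isOpen isOpen_ne
    exact h.preimage (by fun_prop)
  isConic := by
    rintro p ⟨hp, hp0⟩ r hr
    refine ⟨hφ.isConic _ hp r hr, ?_⟩
    have := (hφ.isHomogeneousOn.fderiv_apply hφ.isOpen hφ.isConic (0, 1)).map_smul _ hp r hr
    simp only [Set.mem_ofPred_eq] at hp0 ⊢
    rw [this]
    exact mul_ne_zero (pow_ne_zero _ (by exact_mod_cast hr.ne')) hp0
  ne_zero p hp := hφ.ne_zero _ hp.1
  contDiffOn := hφ.contDiffOn.comp (by fun_prop) fun p hp => hp.1
  homogeneous p hp r hr := hφ.homogeneous _ hp.1 r hr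
  im_nonneg p hp := hφ.im_nonneg _ hp.1
  fderiv_ne_zero p hp h := hp.2 (by
    rw [← fderiv_restrict_apply hφ hp.1, h]
    simp)

theorem contDiff_iteratedFDeriv_snd {E : Type*} [NormedAddCommGroup E] [NormedSpace ℝ E]
    {a : E × F → ℂ} (ha : ContDiff ℝ ∞ a) (k : ℕ) :
    ContDiff ℝ ∞ fun p : E × F => iteratedFDeriv ℝ k (fun θ => a (p.1, θ)) p.2 := by
  induction k with
  | zero =>
    simp only [iteratedFDeriv_zero_eq_comp]
    exact (continuousMultilinearCurryFin0 ℝ F ℂ).symm.contDiff.comp ha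
  | succ k ih =>
    simp only [iteratedFDeriv_succ_eq_comp_left]
    refine (continuousMultilinearCurryLeftEquiv ℝ (fun _ : Fin (k + 1) => F) ℂ).symm.contDiff.comp
      (ContDiff.fderiv (m := ∞) (n := ∞) (g := fun p : E × F => p.2)
        (f := fun p : E × F => iteratedFDeriv ℝ k fun θ => a (p.1, θ)) ?_ contDiff_snd (by simp))
    exact ih.comp ((contDiff_fst.comp contDiff_fst).prodMk contDiff_snd)

theorem IsSymbol.restrict {m ρ δ : ℝ} {a : (X × ℝ) × F → ℂ} (ha : IsSymbol m ρ δ a) (x : X) :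
    IsSymbol m ρ δ fun p : ℝ × F => a ((x, p.1), p.2) := by
  refine ⟨ha.1.comp (by fun_prop), fun K hK k l => ?_⟩
  obtain ⟨C, hC⟩ := ha.2 ((fun t => (x, t)) '' K) (hK.image (by fun_prop)) k l
  refine ⟨C, fun t ht θ => le_trans ?_ (hC (x, t) ⟨t, ht, rfl⟩ θ)⟩
  set G : X × ℝ → ContinuousMultilinearMap ℝ (fun _ : Fin k => F) ℂ :=
    fun y => iteratedFDeriv ℝ k (fun θ' => a (y, θ')) θ with hG
  have hGs : ContDiff ℝ ∞ G :=
    (contDiff_iteratedFDeriv_snd ha.1 k).comp (contDiff_prodMk_left θ)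
  -- The embedding of the line is a translation composed with a linear map of norm at most one, so
  -- the symbol constants do not grow.
  have e : (fun s : ℝ => iteratedFDeriv ℝ k (fun θ' => a ((x, s), θ')) θ) =
      (fun y => G ((x, 0) + y)) ∘ ContinuousLinearMap.inr ℝ X ℝ := by
    ext1 s
    simp [hG]
  have hGs' : ContDiff ℝ ∞ fun y => G ((x, 0) + y) := hGs.comp (by fun_prop)
  rw [e, ContinuousLinearMap.iteratedFDeriv_comp_right _ hGs' t (by exact_mod_cast le_top),
    iteratedFDeriv_comp_add_left]
  refine (ContinuousMultilinearMap.norm_compContinuousLinearMap_le _ _).trans ?_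
  simp only [ContinuousLinearMap.inr_apply, Prod.mk_add_mk, add_zero, zero_add]
  refine mul_le_of_le_one_right (norm_nonneg _) (Finset.prod_le_one (fun _ _ => norm_nonneg _)
    fun _ _ => ?_)
  exact ContinuousLinearMap.opNorm_le_bound _ zero_le_one fun s => by simp [Prod.norm_def]

end Restriction

/-! ### Fourier inversion in the transversal variables -/

section FourierInversion

open scoped FourierTransform RealInnerProductSpace

/-- The value at `x` of the partial integral `∫ h(·,t) dt` is controlled by the Fourier transform of
`h` at the covectors `(ξ, 0)`. -/
theorem norm_integral_le_of_fourier_le {V : Type*} [NormedAddCommGroup V] [InnerProductSpace ℝ V]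
    [FiniteDimensional ℝ V] [MeasurableSpace V] [BorelSpace V] {h : V × ℝ → ℂ}
    (hh : Continuous h) (hc : HasCompactSupport h) {B r : ℝ} (hr : (Module.finrank ℝ V : ℝ) < r)
    (hB : ∀ ξ : V, ‖∫ y : V × ℝ,
      h y * Complex.exp (-Complex.I * ((2 * Real.pi * ⟪ξ, y.1⟫ : ℝ) : ℂ))‖ ≤ B * (1 + ‖ξ‖) ^ (-r)) (x : V) :
    ‖∫ t, h (x, t)‖ ≤ B * ∫ ξ : V, (1 + ‖ξ‖) ^ (-r) := by
  set f : V → ℂ := fun z => ∫ t, h (z, t) with hf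
  have hK1 : IsCompact (Prod.fst '' tsupport h) := hc.isCompact.image continuous_fst
  have hK2 : IsCompact (Prod.snd '' tsupport h) := hc.isCompact.image continuous_snd
  have hfc : Continuous f := by
    have e : f = fun z => ∫ t in Prod.snd '' tsupport h, h (z, t) := by
      ext z
      refine (setIntegral_eq_integral_of_forall_compl_eq_zero fun t ht => ?_).symm
      exact image_eq_zero_of_notMem_tsupport fun hz => ht ⟨_, hz, rfl⟩
    rw [e]
    exact continuous_parametric_integral_of_continuous (f := fun z t => h (z, t)) hh hK2
  have hfs : HasCompactSupport f := by
    refine HasCompactSupport.intro hK1 fun z hz => ?_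
    have : ∀ t, h (z, t) = 0 := fun t =>
      image_eq_zero_of_notMem_tsupport fun hz' => hz ⟨_, hz', rfl⟩
    simp [hf, this]
  -- By Fubini, integrating out `t` amounts to evaluating the full Fourier transform at covectors
  -- with vanishing `t`-component.
  have hF : ∀ ξ, 𝓕 f ξ =
      ∫ y : V × ℝ, h y * Complex.exp (-Complex.I * ((2 * Real.pi * ⟪ξ, y.1⟫ : ℝ) : ℂ)) := by
    intro ξ
    have hg : Continuous fun y : V × ℝ =>
        h y * Complex.exp (-Complex.I * ((2 * Real.pi * ⟪ξ, y.1⟫ : ℝ) : ℂ)) := by fun_prop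
    rw [Real.fourier_eq', Measure.volume_eq_prod,
      integral_prod _ (hg.integrable_of_hasCompactSupport hc.mul_right)]
    refine integral_congr_ae (ae_of_all _ fun z => ?_)
    simp only [hf, smul_eq_mul, ← integral_const_mul]
    refine integral_congr_ae (ae_of_all _ fun t => ?_)
    simp only
    rw [mul_comm, real_inner_comm]
    congr 2
    push_cast
    ring
  have hFm : AEStronglyMeasurable (𝓕 f) volume := by
    have hc : Continuous (Function.uncurry fun (ξ z : V) =>
        Complex.exp ((↑(-2 * Real.pi * ⟪z, ξ⟫) * Complex.I)) • f z) := by fun_prop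
    have := (hc.stronglyMeasurable.integral_prod_right' (ν := (volume : Measure V)))
    refine this.aestronglyMeasurable.congr (ae_of_all _ fun ξ => ?_)
    rw [Real.fourier_eq']
    rfl
  have hFi : Integrable (𝓕 f) :=
    ((integrable_one_add_norm hr).const_mul B).mono' hFm
      (ae_of_all _ fun ξ => by rw [hF]; exact hB ξ)
  have hinv := (hfc.integrable_of_hasCompactSupport hfs).fourierInv_fourier_eq hFi
    hfc.continuousAt (v := x)
  change ‖f x‖ ≤ _
  rw [← hinv, Real.fourierInv_eq', ← integral_const_mul]
  refine norm_integral_le_of_norm_le ((integrable_one_add_norm hr).const_mul B)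
    (ae_of_all _ fun ξ => ?_)
  rw [norm_smul, Complex.norm_exp_ofReal_mul_I, one_mul, hF]
  exact hB ξ

end FourierInversion

/-! ### Independence of the restriction from the approximating sequence -/

section RestrictionContinuity

/-- The product `κ₁ ⊗ ψ` as a test function on `ℝⁿ × ℝ`. -/
def tensorTest {n : ℕ} (κ₁ : EuclideanSpace ℝ (Fin n) → ℝ) (h1 : ContDiff ℝ ∞ κ₁)
    (h2 : HasCompactSupport κ₁) (ψ : 𝓓((⊤ : Opens ℝ), ℝ)) :
    𝓓((⊤ : Opens (SpaceTime n)), ℝ) where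
  toFun y := κ₁ y.1 * ψ y.2
  contDiff' := (h1.comp contDiff_fst).mul (ψ.contDiff.comp contDiff_snd)
  hasCompactSupport' := HasCompactSupport.intro (h2.isCompact.prod ψ.hasCompactSupport.isCompact)
    fun p hp => by
      rw [Set.mem_prod, not_and_or] at hp
      rcases hp with hp | hp <;> simp [image_eq_zero_of_notMem_tsupport hp]
  tsupport_subset' := fun _ _ => trivial

theorem tsupport_tensorTest_subset {n : ℕ} {κ₁ : EuclideanSpace ℝ (Fin n) → ℝ}
    (h1 : ContDiff ℝ ∞ κ₁) (h2 : HasCompactSupport κ₁) (ψ : 𝓓((⊤ : Opens ℝ), ℝ)) :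
    tsupport (tensorTest κ₁ h1 h2 ψ) ⊆ tsupport κ₁ ×ˢ tsupport ψ := by
  refine closure_minimal (fun p hp => ?_)
    ((isClosed_tsupport _).prod (isClosed_tsupport _))
  have hp' : κ₁ p.1 * ψ p.2 ≠ 0 := hp
  rw [mul_ne_zero_iff] at hp'
  exact ⟨subset_closure hp'.1, subset_closure hp'.2⟩

/-- Covectors normalized to the unit sphere form a compact set, so the tube lemma thickens the
disjointness from the conormal set over `x` to a whole ball. The closure of `Γ` is used because `Γ`
is closed only away from the zero section. -/
theorem IsClosedCone.exists_ball_disjoint {n : ℕ} {x : EuclideanSpace ℝ (Fin n)}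
    {Γ : Set (SpaceTime n × (SpaceTime n →L[ℝ] ℝ))} (hΓ : IsClosedCone Γ)
    (hd : Γ ∩ conormal x = ∅) {S : Set ℝ} (hS : IsCompact S) :
    ∃ ε : ℝ, 0 < ε ∧ ∀ z ∈ Metric.ball x ε, ∀ t ∈ S, ∀ l : SpaceTime n →L[ℝ] ℝ,
      l (0, 1) = 0 → ((z, t), l) ∉ Γ := by
  set W : Set (EuclideanSpace ℝ (Fin n) × (ℝ × (SpaceTime n →L[ℝ] ℝ))) :=
    {q | ((q.1, q.2.1), q.2.2) ∉ closure Γ} with hW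
  have hWo : IsOpen W := isClosed_closure.isOpen_compl.preimage
    (f := fun q : EuclideanSpace ℝ (Fin n) × (ℝ × (SpaceTime n →L[ℝ] ℝ)) =>
      ((q.1, q.2.1), q.2.2)) (by fun_prop)
  set L₁ : Set (SpaceTime n →L[ℝ] ℝ) := Metric.sphere 0 1 ∩ {l | l (0, 1) = 0} with hL₁
  have hL₁c : IsCompact L₁ := (isCompact_sphere _ _).inter_right
    (isClosed_eq (by fun_prop) continuous_const)
  have hsub : {x} ×ˢ (S ×ˢ L₁) ⊆ W := by
    rintro ⟨z, t, l⟩ ⟨rfl, -, hl1, hl0⟩ hcl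
    have hl : l ≠ 0 := by
      rintro rfl
      simp at hl1
    have : ((z, t), l) ∈ Γ ∩ conormal z := ⟨hΓ.isClosed _ hcl hl, rfl, hl0⟩
    rw [hd] at this
    exact this
  obtain ⟨u, v, huo, -, hxu, hv, huv⟩ :=
    generalized_tube_lemma isCompact_singleton (hS.prod hL₁c) hWo hsub
  obtain ⟨ε, hε, hεu⟩ := Metric.isOpen_iff.1 huo x (hxu rfl)
  refine ⟨ε, hε, fun z hz t ht l hl0 hmem => ?_⟩
  have hl : 0 < ‖l‖ := norm_pos_iff.2 (hΓ.ne_zero _ hmem)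
  have h1 : (t, ‖l‖⁻¹ • l) ∈ S ×ˢ L₁ := by
    refine ⟨ht, ?_, ?_⟩
    · simp [norm_smul, hl.ne']
    · simp [hl0]
  exact huv (show (z, (t, ‖l‖⁻¹ • l)) ∈ u ×ˢ v from ⟨hεu hz, hv h1⟩)
    (subset_closure (hΓ.isConic _ hmem _ (inv_pos.2 hl)))

/-- Two sequences of smooth functions converging to the same distribution in spaces `𝓓'_Γ` with
cones not meeting the conormal set of `{x} × ℝ` have asymptotically the same restrictions to
`{x} × ℝ`. -/
theorem tendsto_restriction_sub {n : ℕ} {x : EuclideanSpace ℝ (Fin n)}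
    {u : 𝓓'((⊤ : Opens (SpaceTime n)), ℂ)}
    {Γ Γ' : Set (SpaceTime n × (SpaceTime n →L[ℝ] ℝ))} {f g : ℕ → SpaceTime n → ℂ}
    (hΓ : IsClosedCone Γ) (hd : Γ ∩ conormal x = ∅) (hf : TendstoInCone Γ f u)
    (hΓ' : IsClosedCone Γ') (hd' : Γ' ∩ conormal x = ∅) (hg : TendstoInCone Γ' g u)
    (ψ : 𝓓((⊤ : Opens ℝ), ℝ)) :
    Tendsto (fun j => (∫ t : ℝ, f j (x, t) * (ψ t : ℂ)) - ∫ t : ℝ, g j (x, t) * (ψ t : ℂ))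
      atTop (𝓝 0) := by
  obtain ⟨ε, hε, hdis⟩ := hΓ.exists_ball_disjoint hd ψ.hasCompactSupport.isCompact
  obtain ⟨ε', hε', hdis'⟩ := hΓ'.exists_ball_disjoint hd' ψ.hasCompactSupport.isCompact
  have hm : 0 < min ε ε' := lt_min hε hε'
  -- Equal to one at `x` and supported where both cones avoid the covectors `(ξ, 0)`, so both
  -- uniform estimates apply to the same cutoff and the same `V`.
  let κ₁ : ContDiffBump x := ⟨min ε ε' / 4, min ε ε' / 2, by positivity, by linarith⟩
  have hκs : tsupport κ₁ ⊆ Metric.ball x (min ε ε') := by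
    rw [κ₁.tsupport_eq]
    exact Metric.closedBall_subset_ball (show min ε ε' / 2 < min ε ε' by linarith)
  set κ := tensorTest κ₁ κ₁.contDiff κ₁.hasCompactSupport ψ with hκ
  have hκt := tsupport_tensorTest_subset κ₁.contDiff κ₁.hasCompactSupport ψ
  set V : Set (SpaceTime n →L[ℝ] ℝ) := {l | l (0, 1) = 0} with hV
  have hVc : IsClosed V := isClosed_eq (by fun_prop) continuous_const
  have hVcone : ∀ l ∈ V, ∀ r : ℝ, 0 < r → r • l ∈ V := fun l hl r _ => by
    have : l (0, 1) = 0 := hl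
    simp [hV, this]
  have hVΓ : ∀ p ∈ Γ, p.1 ∈ tsupport κ → p.2 ∉ V := fun p hp hpκ hpV =>
    hdis p.1.1 (Metric.ball_subset_ball (min_le_left _ _) (hκs (hκt hpκ).1)) p.1.2 (hκt hpκ).2
      p.2 hpV hp
  have hVΓ' : ∀ p ∈ Γ', p.1 ∈ tsupport κ → p.2 ∉ V := fun p hp hpκ hpV =>
    hdis' p.1.1 (Metric.ball_subset_ball (min_le_right _ _) (hκs (hκt hpκ).1)) p.1.2 (hκt hpκ).2
      p.2 hpV hp
  -- The least integer exponent for which `(1 + ‖ξ‖) ^ (-P)` is integrable on `ℝⁿ`.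
  set P : ℕ := n + 1 with hP
  have hPr : (Module.finrank ℝ (EuclideanSpace ℝ (Fin n)) : ℝ) < (P : ℝ) := by
    rw [finrank_euclideanSpace_fin, hP]; push_cast; linarith
  set I : ℝ := ∫ ξ : EuclideanSpace ℝ (Fin n), (1 + ‖ξ‖) ^ (-(P : ℝ)) with hI
  have hI0 : 0 ≤ I := integral_nonneg fun ξ => by positivity
  rw [Metric.tendsto_nhds]
  intro e he
  obtain ⟨η, hη, hηe⟩ : ∃ η : ℝ, 0 < η ∧ 2 ^ P * (4 * η) * I < e := by
    refine ⟨e / (2 ^ P * 4 * (I + 1) * 2), by positivity, ?_⟩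
    have : 2 ^ P * (4 * (e / (2 ^ P * 4 * (I + 1) * 2))) * I = e * (I / ((I + 1) * 2)) := by
      field_simp
    rw [this]
    refine mul_lt_of_lt_one_right he ?_
    rw [div_lt_one (by positivity)]
    linarith
  -- The weight `‖l‖ ^ P` gives nothing near `l = 0`. Together with exponent `0` it controls `(1 +
  -- ‖ξ‖) ^ P`.
  filter_upwards [hf.uniform κ V hVc hVcone hVΓ 0 η hη, hf.uniform κ V hVc hVcone hVΓ P η hη,
    hg.uniform κ V hVc hVcone hVΓ' 0 η hη, hg.uniform κ V hVc hVcone hVΓ' P η hη]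
    with j hf0 hfP hg0 hgP
  have hfc := (hf.contDiff j).continuous
  have hgc := (hg.contDiff j).continuous
  have hκc : Continuous fun y => (κ y : ℂ) := Complex.continuous_ofReal.comp κ.continuous
  have hκcs : HasCompactSupport fun y => (κ y : ℂ) :=
    κ.hasCompactSupport.comp_left Complex.ofReal_zero
  have hB : ∀ ξ : EuclideanSpace ℝ (Fin n), ‖∫ y : SpaceTime n, (f j y - g j y) * (κ y : ℂ) *
      Complex.exp (-Complex.I * ((2 * Real.pi * inner ℝ ξ y.1 : ℝ) : ℂ))‖ ≤
        2 ^ P * (4 * η) * (1 + ‖ξ‖) ^ (-(P : ℝ)) := by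
    intro ξ
    set l : SpaceTime n →L[ℝ] ℝ :=
      (2 * Real.pi) • (innerSL ℝ ξ).comp (ContinuousLinearMap.fst ℝ _ ℝ) with hl
    have hlV : l ∈ V := by simp [hV, hl]
    have hly : ∀ y : SpaceTime n, l y = 2 * Real.pi * inner ℝ ξ y.1 := fun y => by simp [hl]
    have hξl : ‖ξ‖ ≤ ‖l‖ := by
      have h1 := l.le_opNorm (ξ, 0)
      rw [hly, Real.norm_of_nonneg (by
        have := real_inner_self_nonneg (x := ξ); positivity)] at h1
      simp only [real_inner_self_eq_norm_sq, Prod.norm_def, norm_zero, norm_nonneg,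
        sup_of_le_left] at h1
      by_contra! hlt
      have h2 : 0 < ‖ξ‖ := (norm_nonneg _).trans_lt hlt
      nlinarith [Real.pi_gt_three]
    have hint : ∀ f : SpaceTime n → ℂ, Continuous f →
        Integrable fun y => f y * (κ y : ℂ) * Complex.exp (-Complex.I * (l y : ℂ)) := by
      intro f hf
      have hc : Continuous fun y => f y * (κ y : ℂ) * Complex.exp (-Complex.I * (l y : ℂ)) := by
        fun_prop
      exact hc.integrable_of_hasCompactSupport (hκcs.mul_left.mul_right)
    simp only [← hly]
    -- Both sequences are compared with the same Fourier transform of `κ u`, which cancels.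
    have hsub : ∫ y : SpaceTime n, (f j y - g j y) * (κ y : ℂ) *
        Complex.exp (-Complex.I * (l y : ℂ)) =
        ((∫ y, f j y * (κ y : ℂ) * Complex.exp (-Complex.I * (l y : ℂ))) - localFourier u κ l) -
        ((∫ y, g j y * (κ y : ℂ) * Complex.exp (-Complex.I * (l y : ℂ))) - localFourier u κ l) := by
      rw [sub_sub_sub_cancel_right, ← integral_sub (hint _ hfc) (hint _ hgc)]
      simp only [sub_mul]
    set Df := (∫ y, f j y * (κ y : ℂ) * Complex.exp (-Complex.I * (l y : ℂ))) - localFourier u κ l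
    set Dg := (∫ y, g j y * (κ y : ℂ) * Complex.exp (-Complex.I * (l y : ℂ))) - localFourier u κ l
    rw [hsub]
    have a1 := hf0 l hlV
    have a2 := hfP l hlV
    have a3 := hg0 l hlV
    have a4 := hgP l hlV
    rw [pow_zero, one_mul] at a1 a3
    have hD : ‖Df - Dg‖ ≤ ‖Df‖ + ‖Dg‖ := norm_sub_le _ _
    have hξP : ‖ξ‖ ^ P ≤ ‖l‖ ^ P := pow_le_pow_left₀ (norm_nonneg _) hξl P
    have b1 : ‖ξ‖ ^ P * ‖Df - Dg‖ ≤ 2 * η := by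
      calc ‖ξ‖ ^ P * ‖Df - Dg‖ ≤ ‖l‖ ^ P * (‖Df‖ + ‖Dg‖) := by gcongr
        _ ≤ 2 * η := by linarith
    have b2 : (1 + ‖ξ‖) ^ P ≤ 2 ^ P * (1 + ‖ξ‖ ^ P) := by
      rcases le_total ‖ξ‖ 1 with h | h
      · calc (1 + ‖ξ‖) ^ P ≤ 2 ^ P := pow_le_pow_left₀ (by positivity) (by linarith) P
          _ ≤ _ := le_mul_of_one_le_right (by positivity) (by
            have : 0 ≤ ‖ξ‖ ^ P := by positivity
            linarith)
      · calc (1 + ‖ξ‖) ^ P ≤ (2 * ‖ξ‖) ^ P := pow_le_pow_left₀ (by positivity) (by linarith) P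
          _ = 2 ^ P * ‖ξ‖ ^ P := mul_pow _ _ _
          _ ≤ _ := by gcongr; linarith
    rw [Real.rpow_neg (by positivity), Real.rpow_natCast, ← div_eq_mul_inv,
      le_div_iff₀ (by positivity)]
    calc ‖Df - Dg‖ * (1 + ‖ξ‖) ^ P ≤ ‖Df - Dg‖ * (2 ^ P * (1 + ‖ξ‖ ^ P)) := by gcongr
      _ = 2 ^ P * (‖Df - Dg‖ + ‖ξ‖ ^ P * ‖Df - Dg‖) := by ring
      _ ≤ 2 ^ P * (4 * η) := by gcongr; linarith
  have hh : Continuous fun y : SpaceTime n => (f j y - g j y) * (κ y : ℂ) :=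
    (hfc.sub hgc).mul hκc
  have hfin := norm_integral_le_of_fourier_le hh hκcs.mul_left hPr hB x
  have hint1 : ∀ f : SpaceTime n → ℂ, Continuous f →
      Integrable fun t : ℝ => f (x, t) * (ψ t : ℂ) := by
    intro f hf
    have hψ := ψ.continuous
    have hc : Continuous fun t : ℝ => f (x, t) * (ψ t : ℂ) := by fun_prop
    exact hc.integrable_of_hasCompactSupport
      ((ψ.hasCompactSupport.comp_left Complex.ofReal_zero).mul_left)
  have hval : ∫ t, (f j (x, t) - g j (x, t)) * (κ (x, t) : ℂ) =
      (∫ t : ℝ, f j (x, t) * (ψ t : ℂ)) - ∫ t : ℝ, g j (x, t) * (ψ t : ℂ) := by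
    rw [← integral_sub (hint1 _ hfc) (hint1 _ hgc)]
    refine integral_congr_ae (ae_of_all _ fun t => ?_)
    have hκx : κ (x, t) = ψ t := by
      change κ₁ x * ψ t = ψ t
      rw [κ₁.one_of_mem_closedBall (Metric.mem_closedBall_self κ₁.rIn_pos.le), one_mul]
    simp only [hκx, sub_mul]
  rw [dist_zero_right, ← hval]
  exact hfin.trans_lt hηe

end RestrictionContinuity

/-! ### Exhaustion by compact sets and choice of a basis direction -/

section Exhaustion

theorem exists_exhaustion {E : Type*} [NormedAddCommGroup E] [NormedSpace ℝ E]
    [FiniteDimensional ℝ E] {O : Set E} (hO : IsOpen O) :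
    ∃ K : ℕ → Set E, (∀ k, IsCompact (K k)) ∧ Monotone K ∧ (∀ k, K k ⊆ interior (K (k + 1))) ∧
      (∀ k, K k ⊆ O) ∧ ∀ C : Set E, IsCompact C → C ⊆ O → ∃ k, C ⊆ K k := by
  have : LocallyCompactSpace O := hO.locallyCompactSpace
  let L : CompactExhaustion O := CompactExhaustion.choice O
  refine ⟨fun k => Subtype.val '' L k, fun k => (L.isCompact k).image continuous_subtype_val,
    fun i j hij => Set.image_mono (L.subset hij), fun k => ?_, fun k => ?_, fun C hC hCO => ?_⟩
  · refine (Set.image_mono (L.subset_interior_succ k)).trans (interior_maximal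
      (Set.image_mono interior_subset) (hO.isOpenMap_subtype_val _ isOpen_interior))
  · rintro _ ⟨y, -, rfl⟩
    exact y.2
  · have h1 : IsCompact (Subtype.val ⁻¹' C : Set O) := by
      rw [Subtype.isCompact_iff, Subtype.image_preimage_coe, Set.inter_eq_right.2 hCO]
      exact hC
    obtain ⟨k, hk⟩ := L.exists_superset_of_isCompact h1
    exact ⟨k, fun y hy => ⟨⟨y, hCO hy⟩, hk hy, rfl⟩⟩

/-- The values on a basis control the dual norm; were all of them small, `‖l‖` would be at most `‖l‖
/ 2`. This supplies the direction of integration when `ℓ` dominates `θ`. -/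
theorem exists_basis_direction {E : Type*} [NormedAddCommGroup E] [NormedSpace ℝ E]
    [FiniteDimensional ℝ E] : ∃ c : ℝ, 0 < c ∧ ∀ l : E →L[ℝ] ℝ, l ≠ 0 →
      ∃ i, c * ‖l‖ ≤ |l (Module.finBasis ℝ E i)| := by
  obtain ⟨C, hC, h⟩ := (Module.finBasis ℝ E).exists_opNorm_le (F := ℝ)
  refine ⟨1 / (2 * C), by positivity, fun l hl => ?_⟩
  by_contra! hcon
  have h1 := h (u := l) (M := 1 / (2 * C) * ‖l‖) (by positivity) fun i => (hcon i).le
  have h2 : C * (1 / (2 * C) * ‖l‖) = ‖l‖ / 2 := by field_simp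
  rw [h2] at h1
  have := norm_pos_iff.2 hl
  linarith

end Exhaustion

/-! ### Decay in the covectors near the annihilator of a direction -/

section Decay

variable {E F : Type*} [NormedAddCommGroup E] [NormedSpace ℝ E]
  [NormedAddCommGroup F] [NormedSpace ℝ F]

/-- The points over which `φ` is not stationary in the direction `e` on the conic support of `a`. -/
def nonstationarySet (φ a : E × F → ℂ) (e : E) : Set E :=
  {y | ∀ θ, (y, θ) ∈ coneSupport a → fderiv ℝ φ (y, θ) (e, 0) ≠ 0}

/-- Being outside the closed cone, or inside `Γ` with nonzero derivative, is an open condition. The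
tube lemma over the unit sphere makes it uniform in `θ`, and homogeneity removes the normalization.
-/
theorem isOpen_nonstationarySet [ProperSpace F] {Γ : Set (E × F)} {φ a : E × F → ℂ}
    (hφ : IsPhaseFunction Γ φ) (hcs : coneSupport a ⊆ Γ) (e : E) :
    IsOpen (nonstationarySet φ a e) := by
  rw [isOpen_iff_mem_nhds]
  intro y hy
  set Z := closure {p : E × F | ∃ q ∈ tsupport a, q.2 ≠ 0 ∧ ∃ r : ℝ, 0 < r ∧ p = (q.1, r • q.2)}
  have hno : IsOpen (Zᶜ ∪ (Γ ∩ {p | fderiv ℝ φ p (e, 0) ≠ 0})) :=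
    isClosed_closure.isOpen_compl.union
      ((contDiffOn_fderiv_apply hφ.isOpen hφ.contDiffOn _).continuousOn.isOpen_inter_preimage
        hφ.isOpen isOpen_ne)
  obtain ⟨u, v, huo, -, hyu, hv, huv⟩ := generalized_tube_lemma (isCompact_singleton (x := y))
    (isCompact_sphere (0 : F) 1) hno (by
      rintro ⟨z, θ⟩ ⟨rfl, hθ⟩
      by_cases hz : (z, θ) ∈ Z
      · have hθ0 : θ ≠ 0 := by
          rintro rfl
          simp at hθ
        exact Or.inr ⟨hcs ⟨hz, hθ0⟩, hy θ ⟨hz, hθ0⟩⟩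
      · exact Or.inl hz)
  refine Filter.mem_of_superset (huo.mem_nhds (hyu rfl)) fun z hz θ hp => ?_
  have hn := normalize_mem_coneSupport hp (Set.mem_univ z)
  have h1 : (z, ‖θ‖⁻¹ • θ) ∈ u ×ˢ v := ⟨hz, hv hn.2.2⟩
  have h2 := (hφ.isHomogeneousOn.fderiv_apply hφ.isOpen hφ.isConic e).norm_eq hcs hp
  rcases huv h1 with h | h
  · exact absurd hn.1.1 h
  · rw [← norm_ne_zero_iff, h2]
    exact mul_ne_zero (norm_ne_zero_iff.2 h.2) (pow_ne_zero _ (norm_ne_zero_iff.2 hp.2))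

/-- The test function `κ e^{-iℓ}`. -/
def expTest (κ : E → ℝ) (l : E →L[ℝ] ℝ) (y : E) : ℂ :=
  (κ y : ℂ) * Complex.exp (-Complex.I * (l y : ℂ))

theorem continuous_expTest {κ : E → ℝ} (hκ : Continuous κ) (l : E →L[ℝ] ℝ) :
    Continuous (expTest κ l) := by
  unfold expTest
  fun_prop

theorem hasCompactSupport_expTest {κ : E → ℝ} (hκ : HasCompactSupport κ) (l : E →L[ℝ] ℝ) :
    HasCompactSupport (expTest κ l) :=
  (hκ.comp_left Complex.ofReal_zero).mul_right

variable [FiniteDimensional ℝ E] [MeasureSpace E] [BorelSpace E]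
  [(volume : Measure E).IsAddHaarMeasure] [ProperSpace F]

/-- Over a compact set on which the phase is not stationary in the direction `e`, the localized
oscillatory integral decreases rapidly in the covectors which are almost annihilated by `e`. -/
theorem exists_decay_near_annihilator {Γ : Set (E × F)} {φ a : E × F → ℂ} {m ρ δ : ℝ}
    (hφ : IsPhaseFunction Γ φ) (hcs : coneSupport a ⊆ Γ) (ha : IsSymbol m ρ δ a)
    (hδ₀ : 0 ≤ δ) (hδ₁ : δ < 1) {e : E} {K : Set E} (hK : IsCompact K)
    (hKe : K ⊆ nonstationarySet φ a e) :
    ∃ η : ℝ, 0 < η ∧ ∀ (M : ℕ) (r : ℝ) (κ : E → ℝ), ContDiff ℝ ∞ κ → tsupport κ ⊆ K →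
      ∃ B : ℝ, 0 ≤ B ∧ ∀ (θ : F) (l : E →L[ℝ] ℝ), θ ≠ 0 → |l e| ≤ η * ‖l‖ →
        (1 + ‖l‖) ^ M * ‖fiberIntegral φ a (expTest κ l) θ‖ ≤ B * (1 + ‖θ‖) ^ (-r) := by
  set v := Module.finBasis ℝ E with hv
  have hhom : ∀ w, IsHomogeneousOn Γ 1 fun p => fderiv ℝ φ p (w, 0) := fun w =>
    hφ.isHomogeneousOn.fderiv_apply hφ.isOpen hφ.isConic w
  obtain ⟨c, hc, hlow⟩ := (hhom e).exists_le_norm hcs hK fun y hy θ hp => hKe hy θ hp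
  choose C hC0 hC using fun i => (hhom (v i)).exists_norm_le hcs hK
  simp only [pow_one] at hlow hC
  obtain ⟨c₁, hc₁, hdir⟩ := exists_basis_direction (E := E)
  set D : ℝ := 1 + ∑ i, C i with hD
  have hD0 : 0 < D := by
    have : 0 ≤ ∑ i, C i := Finset.sum_nonneg fun i _ => hC0 i
    linarith
  have hCD : ∀ i, C i ≤ D := fun i => by
    have := Finset.single_le_sum (f := C) (fun i _ => hC0 i) (Finset.mem_univ i)
    linarith
  -- For `‖l‖ ≥ H ‖θ‖`, the derivative of `φ` along a basis vector is at most `D ‖θ‖ ≤ (c₁ / 2)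
  -- ‖l‖`, half of the largest value of `l` guaranteed on the basis.
  set H : ℝ := 2 * D / c₁ with hH
  have hH0 : 0 < H := by positivity
  -- For `‖l‖ < H ‖θ‖` this aperture makes `|l e|` at most `(c / 2) ‖θ‖`, half of the lower bound
  -- for `∂_e φ`.
  refine ⟨c / (2 * H), by positivity, fun M r κ hκ hκK => ?_⟩
  set c' : ℝ := c₁ / 2 / (1 / H + 1) with hc'
  set c'' : ℝ := c / 2 / (1 + H) with hc''
  obtain ⟨k₀, B₀, hB₀, h₀⟩ := exists_fiberIntegral_le hφ hcs ha hδ₀ hδ₁ e hK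
    (show 0 < c'' by positivity) M r
  choose k B hB h using fun i => exists_fiberIntegral_le hφ hcs ha hδ₀ hδ₁ (v i) hK
    (show 0 < c' by positivity) M r
  have hκc : HasCompactSupport κ := hK.of_isClosed_subset (isClosed_tsupport κ) hκK
  choose P hP using fun j : ℕ => (hκc.iteratedFDeriv (𝕜 := ℝ) j).exists_bound_of_continuous
    (hκ.continuous_iteratedFDeriv (m := j) (by exact_mod_cast le_top))
  have hP0 : ∀ j, 0 ≤ P j := fun j => (norm_nonneg _).trans (hP j 0)
  set k' : ℕ := k₀ + ∑ i, k i with hk'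
  set Q : ℝ := ∑ j ∈ Finset.range (k' + 1), P j with hQ
  have hQ0 : 0 ≤ Q := Finset.sum_nonneg fun j _ => hP0 j
  have hPQ : ∀ j ≤ k', ∀ y ∈ K, ‖iteratedFDeriv ℝ j κ y‖ ≤ Q := fun j hj y _ => (hP j y).trans
    (Finset.single_le_sum (fun j _ => hP0 j) (Finset.mem_range.2 (by omega)))
  have hki : ∀ i, k i ≤ k' := fun i => by
    have := Finset.single_le_sum (f := k) (fun i _ => Nat.zero_le _) (Finset.mem_univ i)
    omega
  set B' : ℝ := B₀ + ∑ i, B i with hB'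
  have hsB : 0 ≤ ∑ i, B i := Finset.sum_nonneg fun i _ => hB i
  have hBi : ∀ i, B i ≤ B' := fun i => by
    have := Finset.single_le_sum (f := B) (fun i _ => hB i) (Finset.mem_univ i)
    linarith
  refine ⟨B' * Q, mul_nonneg (by linarith) hQ0, fun θ l hθ hl => ?_⟩
  have hθ0 : 0 < ‖θ‖ := norm_pos_iff.2 hθ
  rcases le_or_gt (H * ‖θ‖) ‖l‖ with hcase | hcase
  · have hl0 : 0 < ‖l‖ := (mul_pos hH0 hθ0).trans_le hcase
    obtain ⟨i, hi⟩ := hdir l (norm_pos_iff.1 hl0)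
    refine (h i θ l hθ (fun y hy hp => ?_) κ hκ hκK Q hQ0
      fun j hj => hPQ j (hj.trans (hki i))).trans ?_
    · have h1 : ‖fderiv ℝ φ (y, θ) (v i, 0)‖ ≤ D * ‖θ‖ :=
        (hC i y hy θ hp).trans (by gcongr; exact hCD i)
      have h2 : |l (v i)| - ‖fderiv ℝ φ (y, θ) (v i, 0)‖ ≤
          ‖fderiv ℝ φ (y, θ) (v i, 0) - (l (v i) : ℂ)‖ := by
        have := norm_sub_norm_le (l (v i) : ℂ) (fderiv ℝ φ (y, θ) (v i, 0))
        rwa [norm_sub_rev, Complex.norm_real, Real.norm_eq_abs] at this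
      have h3 : ‖θ‖ ≤ ‖l‖ / H := by rwa [le_div_iff₀ hH0, mul_comm]
      have h4 : D * (‖l‖ / H) = c₁ / 2 * ‖l‖ := by rw [hH]; field_simp
      have h5 : D * ‖θ‖ ≤ c₁ / 2 * ‖l‖ := by rw [← h4]; gcongr
      have h6 : c' * (‖θ‖ + ‖l‖) ≤ c₁ / 2 * ‖l‖ := by
        calc c' * (‖θ‖ + ‖l‖) ≤ c' * (‖l‖ / H + ‖l‖) := by gcongr
          _ = c₁ / 2 * ‖l‖ := by rw [hc']; field_simp
      linarith
    · gcongr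
      exact hBi i
  · refine (h₀ θ l hθ (fun y hy hp => ?_) κ hκ hκK Q hQ0
      fun j hj => hPQ j (by omega)).trans ?_
    · have h1 := hlow y hy θ hp
      have h2 : ‖fderiv ℝ φ (y, θ) (e, 0)‖ - |l e| ≤
          ‖fderiv ℝ φ (y, θ) (e, 0) - (l e : ℂ)‖ := by
        have := norm_sub_norm_le (fderiv ℝ φ (y, θ) (e, 0)) (l e : ℂ)
        rwa [Complex.norm_real, Real.norm_eq_abs] at this
      have h3 : c / (2 * H) * ‖l‖ ≤ c / 2 * ‖θ‖ := by
        calc c / (2 * H) * ‖l‖ ≤ c / (2 * H) * (H * ‖θ‖) := by gcongr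
          _ = c / 2 * ‖θ‖ := by field_simp
      have h4 : c'' * (‖θ‖ + ‖l‖) ≤ c / 2 * ‖θ‖ := by
        calc c'' * (‖θ‖ + ‖l‖) ≤ c'' * (‖θ‖ + H * ‖θ‖) := by gcongr
          _ = c / 2 * ‖θ‖ := by rw [hc'']; field_simp
      linarith
    · gcongr
      linarith

end Decay

/-! ### The closed cone containing the wave front set -/

section AnnihilatorCone

variable {E : Type*} [NormedAddCommGroup E] [NormedSpace ℝ E]

/-- Given sets `K k` of base points and numbers `η k`, the covectors which, over the interior of
some `K k`, are annihilated by `e` up to the relative error `η k`. -/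
def nearAnnihilator (e : E) (K : ℕ → Set E) (η : ℕ → ℝ) : Set (E × (E →L[ℝ] ℝ)) :=
  {p | ∃ k, p.1 ∈ interior (K k) ∧ |p.2 e| < η k * ‖p.2‖}

theorem isOpen_nearAnnihilator (e : E) (K : ℕ → Set E) (η : ℕ → ℝ) :
    IsOpen (nearAnnihilator e K η) := by
  have : nearAnnihilator e K η = ⋃ k, {p : E × (E →L[ℝ] ℝ) | p.1 ∈ interior (K k)} ∩
      {p | |p.2 e| < η k * ‖p.2‖} := by
    ext p
    simp [nearAnnihilator]
  rw [this]
  refine isOpen_iUnion fun k => (isOpen_interior.preimage continuous_fst).inter ?_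
  exact isOpen_lt (by fun_prop) (by fun_prop)

theorem smul_mem_nearAnnihilator {e : E} {K : ℕ → Set E} {η : ℕ → ℝ} {p : E × (E →L[ℝ] ℝ)}
    (hp : p ∈ nearAnnihilator e K η) {r : ℝ} (hr : 0 < r) :
    (p.1, r • p.2) ∈ nearAnnihilator e K η := by
  obtain ⟨k, hk, h⟩ := hp
  refine ⟨k, hk, ?_⟩
  simp only [smul_apply, smul_eq_mul, abs_mul, norm_smul, Real.norm_eq_abs]
  rw [abs_of_pos hr, mul_left_comm]
  gcongr

theorem isClosedCone_compl_nearAnnihilator (e : E) (K : ℕ → Set E) (η : ℕ → ℝ) :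
    IsClosedCone {p | p.2 ≠ 0 ∧ p ∉ nearAnnihilator e K η} where
  ne_zero _ hp := hp.1
  isConic p hp r hr := ⟨smul_ne_zero hr.ne' hp.1, fun h => hp.2 (by
    simpa [smul_smul, hr.ne'] using smul_mem_nearAnnihilator h (inv_pos.2 hr))⟩
  isClosed p hp h0 := ⟨h0, by
    have h1 : p ∈ closure (nearAnnihilator e K η)ᶜ := closure_mono (fun q hq => hq.2) hp
    rwa [(isOpen_nearAnnihilator e K η).isClosed_compl.closure_eq] at h1⟩

/-- A compact set of base points over which a whole cone of covectors is near the annihilator of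
`e` is contained in some `K k` such that the cone is near the annihilator with the error `η k`. -/
theorem exists_uniform_nearAnnihilator {e : E} {K : ℕ → Set E} {η : ℕ → ℝ} (hK : Monotone K)
    (hη : Antitone η) {S : Set E} (hS : S.Nonempty) (hSK : ∃ k, S ⊆ K k)
    {V : Set (E →L[ℝ] ℝ)} (h : ∀ y ∈ S, ∀ l ∈ V, l ≠ 0 → (y, l) ∈ nearAnnihilator e K η) :
    ∃ k, S ⊆ K k ∧ ∀ l ∈ V, |l e| ≤ η k * ‖l‖ := by
  classical
  refine ⟨Nat.find hSK, Nat.find_spec hSK, fun l hl => ?_⟩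
  -- With the least index taken, `S` has a point outside the preceding `K`. At that point every
  -- available aperture has index at least the least one, and `η` is antitone.
  obtain ⟨y, hy, hyk⟩ : ∃ y ∈ S, ∀ k, y ∈ K k → Nat.find hSK ≤ k := by
    by_contra! hcon
    obtain ⟨y₀, hy₀⟩ := hS
    obtain ⟨k₀, -, hk₀⟩ := hcon y₀ hy₀
    refine Nat.find_min hSK (m := Nat.find hSK - 1) (by omega) fun y hy => ?_
    obtain ⟨k, hyk, hk⟩ := hcon y hy
    exact hK (by omega) hyk
  rcases eq_or_ne l 0 with rfl | hl0
  · simp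
  · obtain ⟨k, hk, hlt⟩ := h y hy l hl hl0
    refine hlt.le.trans ?_
    gcongr
    exact hη (hyk k (interior_subset hk))

end AnnihilatorCone

/-! ### Convergence of the regularizations in a space with wave front control -/

section Convergence

variable {E F : Type*} [NormedAddCommGroup E] [NormedSpace ℝ E]
  [NormedAddCommGroup F] [NormedSpace ℝ F]
  [FiniteDimensional ℝ E] [MeasureSpace E] [BorelSpace E]
  [(volume : Measure E).IsAddHaarMeasure]
  [FiniteDimensional ℝ F] [Nontrivial F] [MeasureSpace F] [BorelSpace F]
  [(volume : Measure F).IsAddHaarMeasure]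

/-- The oscillatory integral regularized by the factor `χ(εθ)`. -/
def regularized (φ a : E × F → ℂ) (χ : 𝓓((⊤ : Opens F), ℝ)) (ε : ℝ) (y : E) : ℂ :=
  ∫ θ : F, (χ (ε • θ) : ℂ) * a (y, θ) * Complex.exp (Complex.I * φ (y, θ))

theorem exists_cutoff : ∃ χ : 𝓓((⊤ : Opens F), ℝ), χ 0 = 1 := by
  let b : ContDiffBump (0 : F) := ⟨1, 2, one_pos, one_lt_two⟩
  exact ⟨⟨b, b.contDiff, b.hasCompactSupport, fun _ _ => trivial⟩,
    b.one_of_mem_closedBall (Metric.mem_closedBall_self zero_le_one)⟩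

variable {Γ : Set (E × F)} {φ a : E × F → ℂ} {m ρ δ : ℝ} {u : 𝓓'((⊤ : Opens E), ℂ)}

theorem tendsto_regularized_localFourier (hφ : IsPhaseFunction Γ φ) (hcs : coneSupport a ⊆ Γ)
    (hu : IsOscillatoryIntegral m ρ δ φ a u) {χ : 𝓓((⊤ : Opens F), ℝ)} (hχ : χ 0 = 1)
    (κ : 𝓓((⊤ : Opens E), ℝ)) (l : E →L[ℝ] ℝ) :
    Tendsto (fun ε : ℝ => ∫ y, regularized φ a χ ε y * expTest κ l y) (𝓝[>] 0)
      (𝓝 (localFourier u κ l)) := by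
  have h1 := hu.tendsto χ hχ (modulate κ Real.cos Real.contDiff_cos l)
  have h2 := hu.tendsto χ hχ (modulate κ Real.sin Real.contDiff_sin l)
  refine (h1.sub (h2.const_mul Complex.I)).congr' ?_
  filter_upwards [self_mem_nhdsWithin] with ε hε
  have hc : Continuous (regularized φ a χ ε) :=
    (contDiff_regularized hφ hcs hu.symbol.1 (continuous_cutoff χ ε)
      (hasCompactSupport_cutoff χ (ne_of_gt hε))).continuous
  have hint : ∀ ψ : 𝓓((⊤ : Opens E), ℝ), Integrable fun y => regularized φ a χ ε y * (ψ y : ℂ) :=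
    fun ψ => (hc.mul (Complex.continuous_ofReal.comp
      ψ.continuous)).integrable_of_hasCompactSupport
      ((ψ.hasCompactSupport.comp_left Complex.ofReal_zero).mul_left)
  change (∫ y, regularized φ a χ ε y * (modulate κ Real.cos Real.contDiff_cos l y : ℂ)) -
    Complex.I * (∫ y, regularized φ a χ ε y * (modulate κ Real.sin Real.contDiff_sin l y : ℂ)) = _
  rw [← integral_const_mul, ← integral_sub (hint _) ((hint _).const_mul _)]
  refine integral_congr_ae (ae_of_all _ fun y => ?_)
  have e1 : (modulate κ Real.cos Real.contDiff_cos l) y = κ y * Real.cos (l y) := rfl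
  have e2 : (modulate κ Real.sin Real.contDiff_sin l) y = κ y * Real.sin (l y) := rfl
  have e3 : Complex.exp (-Complex.I * (l y : ℂ)) =
      Complex.cos (l y) - Complex.sin (l y) * Complex.I := by
    rw [show -Complex.I * (l y : ℂ) = (-(l y : ℂ)) * Complex.I by ring, Complex.exp_mul_I,
      Complex.cos_neg, Complex.sin_neg]
    ring
  simp only [e1, e2, expTest, e3]
  push_cast
  ring

/-- The decay makes the fibre integral integrable in `θ`, and uniqueness of limits identifies its
integral with the Fourier transform of `κ u`. Both conclusions are linear in `B`, so decay of `B` in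
`l` is inherited; the first serves the wave front set, the second the uniform convergence. -/
theorem norm_regularized_sub_localFourier_le (hφ : IsPhaseFunction Γ φ)
    (hcs : coneSupport a ⊆ Γ) (hu : IsOscillatoryIntegral m ρ δ φ a u)
    (κ : 𝓓((⊤ : Opens E), ℝ)) (l : E →L[ℝ] ℝ) {B r : ℝ}
    (hr : (Module.finrank ℝ F : ℝ) < r)
    (h : ∀ θ, θ ≠ 0 → ‖fiberIntegral φ a (expTest κ l) θ‖ ≤ B * (1 + ‖θ‖) ^ (-r)) :
    ‖localFourier u κ l‖ ≤ B * ∫ θ : F, (1 + ‖θ‖) ^ (-r) ∧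
    ∀ χ : 𝓓((⊤ : Opens F), ℝ), χ 0 = 1 → ∀ ε : ℝ, ε ≠ 0 →
      ‖(∫ y, regularized φ a χ ε y * expTest κ l y) - localFourier u κ l‖ ≤
        B * cutoffError χ r ε := by
  have hκ := continuous_expTest κ.continuous l
  have hκc := hasCompactSupport_expTest κ.hasCompactSupport l
  have key : localFourier u κ l = ∫ θ, fiberIntegral φ a (expTest κ l) θ := by
    obtain ⟨χ, hχ⟩ := exists_cutoff (F := F)
    exact tendsto_nhds_unique (tendsto_regularized_localFourier hφ hcs hu hχ κ l)
      (tendsto_regularized hφ hcs hu.symbol.1 hκ hκc hr h χ hχ)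
  refine ⟨?_, fun χ _ ε hε => ?_⟩
  · rw [key, ← integral_const_mul]
    exact norm_integral_le_of_norm_le ((integrable_one_add_norm hr).const_mul B)
      (ae_ne_zero.mono h)
  · rw [key]
    exact norm_regularized_sub_le hφ hcs hu.symbol.1 hκ hκc hr h χ hε

/-- An oscillatory integral whose phase is not stationary in the direction `e` over a set `T` is
the limit, in `𝓓'_Λ` for some closed cone `Λ` without covectors over `T` annihilated by `e`, of
its regularizations. -/
theorem exists_tendstoInCone_regularized (hφ : IsPhaseFunction Γ φ) (hcs : coneSupport a ⊆ Γ)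
    (hδ₀ : 0 ≤ δ) (hδ₁ : δ < 1) (hu : IsOscillatoryIntegral m ρ δ φ a u) {e : E}
    {χ : 𝓓((⊤ : Opens F), ℝ)} (hχ : χ 0 = 1) :
    ∃ Λ : Set (E × (E →L[ℝ] ℝ)), IsClosedCone Λ ∧
      (∀ p ∈ Λ, p.1 ∈ nonstationarySet φ a e → p.2 e ≠ 0) ∧
      TendstoInCone Λ (fun j => regularized φ a χ (1 / ((j : ℝ) + 1))) u := by
  have ha := hu.symbol
  obtain ⟨K, hKc, hKm, hKi, hKO, hKex⟩ := exists_exhaustion (isOpen_nonstationarySet hφ hcs e)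
  choose η₀ hη₀ hdec₀ using fun k =>
    exists_decay_near_annihilator hφ hcs ha hδ₀ hδ₁ (hKc k) (hKO k)
  -- Running minima make the apertures decrease along the exhaustion, as
  -- `exists_uniform_nearAnnihilator` requires.
  obtain ⟨η, hη, hηm, hηle⟩ : ∃ η : ℕ → ℝ, (∀ k, 0 < η k) ∧ Antitone η ∧ ∀ k, η k ≤ η₀ k :=
    ⟨fun k => (Finset.range (k + 1)).inf' Finset.nonempty_range_add_one η₀,
      fun k => (Finset.lt_inf'_iff _).2 fun j _ => hη₀ j,
      fun i j hij => Finset.inf'_mono _ (Finset.range_mono (by omega)) _,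
      fun k => Finset.inf'_le _ (by simp)⟩
  have hdec : ∀ k (M : ℕ) (r : ℝ) (κ : E → ℝ), ContDiff ℝ ∞ κ → tsupport κ ⊆ K k →
      ∃ B : ℝ, 0 ≤ B ∧ ∀ (θ : F) (l : E →L[ℝ] ℝ), θ ≠ 0 → |l e| ≤ η k * ‖l‖ →
        (1 + ‖l‖) ^ M * ‖fiberIntegral φ a (expTest κ l) θ‖ ≤ B * (1 + ‖θ‖) ^ (-r) := by
    intro k M r κ hκ hκK
    obtain ⟨B, hB, h⟩ := hdec₀ k M r κ hκ hκK
    exact ⟨B, hB, fun θ l hθ hl => h θ l hθ (hl.trans (by gcongr; exact hηle k))⟩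
  obtain ⟨r, hr⟩ := exists_gt (Module.finrank ℝ F : ℝ)
  have hdiv : ∀ {M : ℕ} {B : ℝ} {κ : E → ℝ} {l : E →L[ℝ] ℝ},
      (∀ θ : F, θ ≠ 0 → (1 + ‖l‖) ^ M * ‖fiberIntegral φ a (expTest κ l) θ‖ ≤
        B * (1 + ‖θ‖) ^ (-r)) →
      ∀ θ : F, θ ≠ 0 → ‖fiberIntegral φ a (expTest κ l) θ‖ ≤
        B / (1 + ‖l‖) ^ M * (1 + ‖θ‖) ^ (-r) := by
    intro M B κ l h θ hθ
    rw [div_mul_eq_mul_div, le_div_iff₀ (by positivity), mul_comm]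
    exact h θ hθ
  have hεpos : ∀ j : ℕ, (0 : ℝ) < 1 / ((j : ℝ) + 1) := fun j => by positivity
  have hε : Tendsto (fun j : ℕ => 1 / ((j : ℝ) + 1)) atTop (𝓝[>] 0) :=
    tendsto_nhdsWithin_iff.2 ⟨tendsto_one_div_add_atTop_nhds_zero_nat,
      Eventually.of_forall hεpos⟩
  refine ⟨{p | p.2 ≠ 0 ∧ p ∉ nearAnnihilator e K η}, isClosedCone_compl_nearAnnihilator e K η,
    ?_, ⟨fun j => ?_, ?_, fun ψ => ?_, ?_⟩⟩
  · rintro p ⟨hp0, hp⟩ hpO hpe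
    obtain ⟨k, hk⟩ := hKex {p.1} isCompact_singleton (Set.singleton_subset_iff.2 hpO)
    -- The index is shifted because the point must lie in the interior of the compact set.
    refine hp ⟨k + 1, hKi k (hk rfl), ?_⟩
    rw [hpe, abs_zero]
    exact mul_pos (hη _) (norm_pos_iff.2 hp0)
  · exact contDiff_regularized hφ hcs ha.1 (continuous_cutoff χ _)
      (hasCompactSupport_cutoff χ (hεpos j).ne')
  · rintro ⟨y, l₀⟩ ⟨hl₀, hWF⟩
    refine ⟨hl₀, fun ⟨k, hk, hlt⟩ => hWF ?_⟩
    obtain ⟨d, hd, hdk⟩ := Metric.isOpen_iff.1 isOpen_interior y hk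
    let b : ContDiffBump y := ⟨d / 4, d / 2, by positivity, by linarith⟩
    let κ : 𝓓((⊤ : Opens E), ℝ) := ⟨b, b.contDiff, b.hasCompactSupport, fun _ _ => trivial⟩
    have hκK : tsupport κ ⊆ K k := by
      have h1 : tsupport b ⊆ Metric.ball y d := by
        rw [b.tsupport_eq]
        exact Metric.closedBall_subset_ball (show d / 2 < d by linarith)
      exact (h1.trans hdk).trans interior_subset
    refine ⟨κ, ?_, {l | |l e| < η k * ‖l‖}, isOpen_lt (by fun_prop) (by fun_prop), hlt,
      fun l hl s hs => ?_, fun M => ?_⟩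
    · have h1 : b y = 1 :=
        b.one_of_mem_closedBall (Metric.mem_closedBall_self b.rIn_pos.le)
      change b y ≠ 0
      rw [h1]
      exact one_ne_zero
    · have hl' : |l e| < η k * ‖l‖ := hl
      change |(s • l) e| < η k * ‖s • l‖
      simp only [smul_apply, smul_eq_mul, abs_mul, norm_smul, Real.norm_eq_abs, abs_of_pos hs]
      rw [mul_left_comm]
      gcongr
    · obtain ⟨B, hB, h⟩ := hdec k M r κ κ.contDiff hκK
      refine ⟨B * ∫ θ : F, (1 + ‖θ‖) ^ (-r), fun l hl => ?_⟩
      have h1 := (norm_regularized_sub_localFourier_le hφ hcs hu κ l hr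
        (hdiv fun θ hθ => h θ l hθ (le_of_lt hl))).1
      rwa [div_mul_eq_mul_div, le_div_iff₀ (by positivity), mul_comm] at h1
  · exact (hu.tendsto χ hχ ψ).comp hε
  · intro κ V hVc hVcone hVΛ M ζ hζ
    -- A nonzero covector in `V` forces the support of `κ` into the nonstationary set. Otherwise
    -- only `l = 0` can occur, where `κ` is unrestricted but weak convergence is enough.
    by_cases hV : ∃ l ∈ V, l ≠ 0
    · obtain ⟨l₁, hl₁, hl₁0⟩ := hV
      obtain ⟨B, hB, h⟩ : ∃ B : ℝ, 0 ≤ B ∧ ∀ (θ : F) (l : E →L[ℝ] ℝ), θ ≠ 0 → l ∈ V →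
          (1 + ‖l‖) ^ M * ‖fiberIntegral φ a (expTest κ l) θ‖ ≤ B * (1 + ‖θ‖) ^ (-r) := by
        rcases (tsupport κ).eq_empty_or_nonempty with hemp | hne
        · have hκ0 : ∀ y, κ y = 0 := fun y =>
            image_eq_zero_of_notMem_tsupport (by rw [hemp]; simp)
          refine ⟨0, le_rfl, fun θ l _ _ => ?_⟩
          have : fiberIntegral φ a (expTest κ l) θ = 0 := by
            simp [fiberIntegral, expTest, hκ0]
          simp [this]
        · have hgood : ∀ y ∈ tsupport κ, ∀ l ∈ V, l ≠ 0 → (y, l) ∈ nearAnnihilator e K η := by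
            intro y hy l hl hl0
            by_contra hcon
            exact hVΛ (y, l) ⟨hl0, hcon⟩ hy hl
          have hκO : tsupport κ ⊆ nonstationarySet φ a e := fun y hy => by
            obtain ⟨k, hk, -⟩ := hgood y hy l₁ hl₁ hl₁0
            exact hKO k (interior_subset hk)
          obtain ⟨k, hk, hkV⟩ := exists_uniform_nearAnnihilator hKm hηm hne
            (hKex _ κ.hasCompactSupport.isCompact hκO) hgood
          obtain ⟨B, hB, h⟩ := hdec k M r κ κ.contDiff hk
          exact ⟨B, hB, fun θ l hθ hl => h θ l hθ (hkV l hl)⟩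
      have hlim : Tendsto (fun j : ℕ => B * cutoffError χ r (1 / ((j : ℝ) + 1))) atTop (𝓝 0) := by
        simpa using ((tendsto_cutoffError χ hχ hr).comp hε).const_mul B
      -- The bound `B * cutoffError` does not involve `l`, hence uniformity over `V`.
      filter_upwards [hlim.eventually_le_const hζ] with j hj l hl
      have h1 := (norm_regularized_sub_localFourier_le hφ hcs hu κ l hr
        (hdiv fun θ hθ => h θ l hθ hl)).2 χ hχ _ (hεpos j).ne'
      simp only [mul_assoc]
      refine le_trans ?_ hj
      rw [div_mul_eq_mul_div, le_div_iff₀ (by positivity), mul_comm] at h1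
      refine le_trans ?_ h1
      gcongr
      · linarith
      · rfl
    · push Not at hV
      have hlim := (tendsto_regularized_localFourier hφ hcs hu hχ κ 0).comp hε
      rw [tendsto_iff_norm_sub_tendsto_zero] at hlim
      filter_upwards [hlim.eventually_le_const hζ] with j hj l hl
      rw [hV l hl]
      simp only [mul_assoc]
      refine le_trans ?_ hj
      refine mul_le_of_le_one_left (norm_nonneg _) ?_
      rw [norm_zero]
      exact pow_le_one₀ le_rfl zero_le_one

end Convergence

end OscInt

end

theorem mainTheorem7 (n N : ℕ) (hN : 0 < N) (m ρ δ : ℝ)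
    (hρ₀ : 0 < ρ) (hρ₁ : ρ ≤ 1) (hδ₀ : 0 ≤ δ) (hδ₁ : δ < 1)
    (φ a : OscInt.SpaceTime n × EuclideanSpace ℝ (Fin N) → ℂ)
    (u : 𝓓'((⊤ : Opens (OscInt.SpaceTime n)), ℂ))
    (hu : OscInt.IsOscillatoryIntegral m ρ δ φ a u)
    (x : EuclideanSpace ℝ (Fin n))
    (hres : OscInt.RestrictionCondition x u)
    (hφ : ∀ (t : ℝ) (θ : EuclideanSpace ℝ (Fin N)), ((x, t), θ) ∈ OscInt.coneSupport a →
      deriv (fun s : ℝ => φ ((x, s), θ)) t ≠ 0) :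
    ∃ ux : 𝓓'((⊤ : Opens ℝ), ℂ),
      OscInt.IsRestriction x u ux ∧
      OscInt.IsOscillatoryIntegral m ρ δ
        (fun p : ℝ × EuclideanSpace ℝ (Fin N) => φ ((x, p.1), p.2))
        (fun p : ℝ × EuclideanSpace ℝ (Fin N) => a ((x, p.1), p.2)) ux := by
  have : NeZero N := ⟨hN.ne'⟩
  have : (volume : Measure (OscInt.SpaceTime n)).IsAddHaarMeasure :=
    inferInstanceAs ((volume : Measure (EuclideanSpace ℝ (Fin n))).prod
      (volume : Measure ℝ)).IsAddHaarMeasure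
  obtain ⟨Γ, hΓ, hcs⟩ := hu.phase
  have hD : ∀ (t : ℝ) (θ : EuclideanSpace ℝ (Fin N)), ((x, t), θ) ∈ OscInt.coneSupport a →
      fderiv ℝ φ ((x, t), θ) ((0, 1), 0) ≠ 0 := fun t θ hp => by
    rw [← OscInt.deriv_restrict hΓ (hcs hp)]
    exact hφ t θ hp
  have hcs' : OscInt.coneSupport (fun p : ℝ × EuclideanSpace ℝ (Fin N) => a ((x, p.1), p.2)) ⊆
      {p | ((x, p.1), p.2) ∈ Γ ∩ {p | fderiv ℝ φ p ((0, 1), 0) ≠ 0}} := fun p hp =>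
    ⟨hcs (OscInt.coneSupport_restrict_subset hp), hD _ _ (OscInt.coneSupport_restrict_subset hp)⟩
  -- The candidate is built directly on the line; `1` is the direction `∂_t`.
  obtain ⟨ux, hux, -⟩ := OscInt.exists_isOscillatoryIntegral (hΓ.restrict x) hcs'
    (hu.symbol.restrict x) hδ₀ hδ₁ 1 fun p hp => by
      rw [OscInt.fderiv_restrict_apply hΓ (hcs' hp).1]
      exact (hcs' hp).2
  obtain ⟨χ, hχ⟩ := OscInt.exists_cutoff (F := EuclideanSpace ℝ (Fin N))
  obtain ⟨Λ, hΛ, hΛe, hlim⟩ := OscInt.exists_tendstoInCone_regularized hΓ hcs hδ₀ hδ₁ hu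
    (e := (0, 1)) hχ
  have hΛx : Λ ∩ OscInt.conormal x = ∅ := by
    rw [Set.eq_empty_iff_forall_notMem]
    rintro ⟨⟨z, t⟩, l⟩ ⟨hp, rfl, hl⟩
    exact hΛe _ hp (fun θ hθ => hD t θ hθ) hl
  -- Inserting the cutoff in `θ` commutes with fixing `x`, so these are the regularizations of the
  -- one-dimensional integral.
  have hreg : ∀ ψ : 𝓓((⊤ : Opens ℝ), ℝ), Tendsto (fun j : ℕ => ∫ t : ℝ,
      OscInt.regularized φ a χ (1 / ((j : ℝ) + 1)) (x, t) * (ψ t : ℂ)) atTop (𝓝 (ux ψ)) := by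
    intro ψ
    exact (hux.tendsto χ hχ ψ).comp (tendsto_nhdsWithin_iff.2
      ⟨tendsto_one_div_add_atTop_nhds_zero_nat, Eventually.of_forall fun j =>
        show (0 : ℝ) < 1 / ((j : ℝ) + 1) by positivity⟩)
  refine ⟨ux, ⟨⟨Λ, _, hΛ, hΛx, hlim⟩, fun Γ' f hΓ' hd hf ψ => ?_⟩, hux⟩
  -- An arbitrary admissible sequence differs on the line from the regularizations by a null
  -- sequence.
  simpa using (OscInt.tendsto_restriction_sub hΓ' hd hf hΛ hΛx hlim ψ).add (hreg ψ)
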